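/- Let $(M,g)$ be a smooth Riemannian surface, with Levi-Civita connection $D$, Riemann tensor $R$ (with the convention $A_{c;ba}-A_{c;ab}={R_{abc}}^{d}A_d$), and Gaussian curvature $c$; write $\partial c$ for the gradient of $c$. On the vector bundle $W=T^*M\oplus\Lambda^2T^*M$ let $\nabla$ be the connection $$\nabla_i(K,L)=\bigl(K_{a;i}-L_{ai},\ L_{ab;i}-{R_{abi}}^{c}K_c\bigr),$$ and let $F$ be its curvature. For a subset $V\subseteq W$ whose fibres are linear subspaces, let $\mathcal S(V)\subseteq V$ be the set of those $v\in V$ that lie on the image of a smooth local section of $W$ with values in $V$; if $V=\mathcal S(V)$, let $\alpha_{V}:V\to (W/V)\otimes T^*M$ be the fibrewise linear map $\alpha_V(s(x))=\nabla s(x) \bmod V$ for local smooth sections $s$ of $V$. Put $$V^{(0)}=\{w\in W: F(\cdot,\cdot)(w)=0\},\qquad W^{(i)}=\mathcal S(V^{(i)}),\qquad V^{(i+1)}=\ker\alpha_{W^{(i)}}\qquad(i\ge 0),$$ and call $(M,g)$ regular if for every $i\ge 0$ one has $W^{(i)}=V^{(i)}$ and the fibres of this set have the same dimension at all points of $M$.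 Theorem. If $(M,g)$ is regular and possesses a Killing field, i.e. a smooth $1$-form $K$ on $M$, not identically zero, with $K_{a;b}+K_{b;a}=0$, then $$dc\wedge D_{\partial c}\,dc=0\quad\text{on } M.$$ Equivalently, the Hessian of $c$ maps $\partial c$ to a multiple of itself: there is a function $f:M\to\mathbb R$ with $D_{\partial c}\partial c=f\,\partial c$. -/

import Mathlib

open Bundle FiberBundle Topology
open scoped Manifold ContDiff

noncomputable section

set_option linter.unusedSectionVars false

namespace RiemannianGeometry
section
variable {E : Type*} [NormedAddCommGroup E] [NormedSpace ℝ E] [FiniteDimensional ℝ E]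
  {H : Type*} [TopologicalSpace H] {I : ModelWithCorners ℝ E H}
  {M : Type*} [TopologicalSpace M] [ChartedSpace H M] [IsManifold I ∞ M]

instance finiteDimensional_tangentSpace (x : M) : FiniteDimensional ℝ (TangentSpace I x) :=
  inferInstanceAs (FiniteDimensional ℝ E)

instance t2Space_tangentSpace (x : M) : T2Space (TangentSpace I x) :=
  inferInstanceAs (T2Space E)


/-- The right-hand side of the Koszul formula for `g(D_X Y, Z)`, where `D` is the Levi-Civita
connection of `g`. -/
def koszul (g : ContMDiffRiemannianMetric I ∞ E (TangentSpace I : M → Type _))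
    (X Y Z : Π x : M, TangentSpace I x) (x : M) : ℝ :=
  (1 / 2 : ℝ) * (mvfderiv I (fun y ↦ g.inner y (Y y) (Z y)) x (X x)
  + mvfderiv I (fun y ↦ g.inner y (X y) (Z y)) x (Y x)
  - mvfderiv I (fun y ↦ g.inner y (X y) (Y y)) x (Z x)
  + g.inner x (VectorField.mlieBracket I X Y x) (Z x)
  - g.inner x (VectorField.mlieBracket I X Z x) (Y x)
  - g.inner x (VectorField.mlieBracket I Y Z x) (X x))

variable (g : ContMDiffRiemannianMetric I ∞ E (TangentSpace I : M → Type _))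
variable {X Y Z : Π x : M, TangentSpace I x} {x : M}

theorem mdifferentiableAt_inner (hX : MDiffAt (T% X) x) (hY : MDiffAt (T% Y) x) :
    MDiffAt (fun y ↦ g.inner y (X y) (Y y)) x := by
  have h : MDifferentiableAt I (I.prod 𝓘(ℝ))
      (fun m ↦ TotalSpace.mk' ℝ (E := Bundle.Trivial M ℝ) m (g.inner m (X m) (Y m))) x := by
    apply MDifferentiableAt.clm_bundle_apply₂ (F₁ := E) (F₂ := E)
    · exact g.contMDiff.mdifferentiableAt (by simp)
    · exact hX
    · exact hY
  rw [mdifferentiableAt_totalSpace] at h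
  exact h.2

theorem koszul_tensorial_left (hY : MDiffAt (T% Y) x) (hZ : MDiffAt (T% Z) x) :
    TensorialAt I E (fun X ↦ koszul g X Y Z x) x where
  smul {f X} hf hX := by
    have h1 (Z : Π x : M, TangentSpace I x) : (fun y ↦ g.inner y ((f • X) y) (Z y)) =
        f * fun y ↦ g.inner y (X y) (Z y) := by
      ext y; simp
    simp only [koszul]
    rw [h1, h1, mvfderiv_mul hf (mdifferentiableAt_inner g hX hZ),
      mvfderiv_mul hf (mdifferentiableAt_inner g hX hY),
      VectorField.mlieBracket_smul_left hf hX, VectorField.mlieBracket_smul_left hf hX]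
    simp
    ring
  add {X X'} hX hX' := by
    have h1 (Z : Π x : M, TangentSpace I x) : (fun y ↦ g.inner y ((X + X') y) (Z y)) =
        (fun y ↦ g.inner y (X y) (Z y)) + fun y ↦ g.inner y (X' y) (Z y) := by
      ext y; simp
    simp only [koszul]
    rw [h1, h1, mvfderiv_add (mdifferentiableAt_inner g hX hZ) (mdifferentiableAt_inner g hX' hZ),
      mvfderiv_add (mdifferentiableAt_inner g hX hY) (mdifferentiableAt_inner g hX' hY),
      VectorField.mlieBracket_add_left hX hX', VectorField.mlieBracket_add_left hX hX']
    simp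
    ring

theorem koszul_tensorial_right (hX : MDiffAt (T% X) x) (hY : MDiffAt (T% Y) x) :
    TensorialAt I E (fun Z ↦ koszul g X Y Z x) x where
  smul {f Z} hf hZ := by
    have h1 (X : Π x : M, TangentSpace I x) : (fun y ↦ g.inner y (X y) ((f • Z) y)) =
        f * fun y ↦ g.inner y (X y) (Z y) := by
      ext y; simp
    simp only [koszul]
    rw [h1, h1, mvfderiv_mul hf (mdifferentiableAt_inner g hX hZ),
      mvfderiv_mul hf (mdifferentiableAt_inner g hY hZ),
      VectorField.mlieBracket_smul_right hf hZ, VectorField.mlieBracket_smul_right hf hZ]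
    simp [g.symm x (Z x)]
    ring
  add {Z Z'} hZ hZ' := by
    have h1 (X : Π x : M, TangentSpace I x) : (fun y ↦ g.inner y (X y) ((Z + Z') y)) =
        (fun y ↦ g.inner y (X y) (Z y)) + fun y ↦ g.inner y (X y) (Z' y) := by
      ext y; simp
    simp only [koszul]
    rw [h1, h1, mvfderiv_add (mdifferentiableAt_inner g hX hZ) (mdifferentiableAt_inner g hX hZ'),
      mvfderiv_add (mdifferentiableAt_inner g hY hZ) (mdifferentiableAt_inner g hY hZ'),
      VectorField.mlieBracket_add_right hZ hZ', VectorField.mlieBracket_add_right hZ hZ']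
    simp
    ring

theorem koszul_add_middle {Y'} (hX : MDiffAt (T% X) x) (hY : MDiffAt (T% Y) x)
    (hY' : MDiffAt (T% Y') x) (hZ : MDiffAt (T% Z) x) :
    koszul g X (Y + Y') Z x = koszul g X Y Z x + koszul g X Y' Z x := by
  have h1 (X : Π x : M, TangentSpace I x) : (fun y ↦ g.inner y (X y) ((Y + Y') y)) =
      (fun y ↦ g.inner y (X y) (Y y)) + fun y ↦ g.inner y (X y) (Y' y) := by
    ext y; simp
  have h2 (X : Π x : M, TangentSpace I x) : (fun y ↦ g.inner y ((Y + Y') y) (X y)) =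
      (fun y ↦ g.inner y (Y y) (X y)) + fun y ↦ g.inner y (Y' y) (X y) := by
    ext y; simp
  simp only [koszul]
  rw [h1, h2, mvfderiv_add (mdifferentiableAt_inner g hX hY) (mdifferentiableAt_inner g hX hY'),
    mvfderiv_add (mdifferentiableAt_inner g hY hZ) (mdifferentiableAt_inner g hY' hZ),
    VectorField.mlieBracket_add_right hY hY', VectorField.mlieBracket_add_left hY hY']
  simp
  ring

theorem koszul_smul_middle {f : M → ℝ} (hX : MDiffAt (T% X) x) (hf : MDiffAt f x)
    (hY : MDiffAt (T% Y) x) (hZ : MDiffAt (T% Z) x) :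
    koszul g X (f • Y) Z x = f x * koszul g X Y Z x +
      mvfderiv I f x (X x) * g.inner x (Y x) (Z x) := by
  have h1 (X : Π x : M, TangentSpace I x) : (fun y ↦ g.inner y (X y) ((f • Y) y)) =
      f * (fun y ↦ g.inner y (X y) (Y y)) := by
    ext y; simp
  have h2 (X : Π x : M, TangentSpace I x) : (fun y ↦ g.inner y ((f • Y) y) (X y)) =
      f * (fun y ↦ g.inner y (Y y) (X y)) := by
    ext y; simp
  simp only [koszul]
  rw [h1, h2, mvfderiv_mul hf (mdifferentiableAt_inner g hX hY),
    mvfderiv_mul hf (mdifferentiableAt_inner g hY hZ),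
    VectorField.mlieBracket_smul_right hf hY, VectorField.mlieBracket_smul_left hf hY]
  simp [g.symm x (Y x) (X x)]
  ring


open Classical in
/-- The bilinear form `(X, Z) ↦ g(D_X Y, Z)` on the tangent space at `x` that is determined by the
Koszul formula (`0` at points where `Y` is not differentiable). -/
def koszulForm (Y : Π x : M, TangentSpace I x) (x : M) :
    TangentSpace I x →L[ℝ] TangentSpace I x →L[ℝ] ℝ :=
  if hY : MDiffAt (T% Y) x then
    TensorialAt.mkHom₂ (fun X Z ↦ koszul g X Y Z x) x
      (fun _ hZ ↦ koszul_tensorial_left g hY hZ) (fun _ hX ↦ koszul_tensorial_right g hX hY)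
  else 0

theorem koszulForm_apply (hX : MDiffAt (T% X) x) (hY : MDiffAt (T% Y) x) (hZ : MDiffAt (T% Z) x) :
    koszulForm g Y x (X x) (Z x) = koszul g X Y Z x := by
  rw [koszulForm, dif_pos hY]
  exact TensorialAt.mkHom₂_apply _ _ hX hZ

theorem koszulForm_apply' (hY : MDiffAt (T% Y) x) (u v : TangentSpace I x) :
    koszulForm g Y x u v = koszul g (extend E u) Y (extend E v) x := by
  rw [koszulForm, dif_pos hY]
  rfl

/-- The musical isomorphism `v ↦ g(v, ·)` from tangent vectors to covectors. -/
def flat (x : M) : TangentSpace I x ≃ₗ[ℝ] (TangentSpace I x →L[ℝ] ℝ) :=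
  LinearEquiv.ofBijective
    (g.inner x : TangentSpace I x →ₗ[ℝ] (TangentSpace I x →L[ℝ] ℝ)) (by
    have hinj : Function.Injective
        (g.inner x : TangentSpace I x →ₗ[ℝ] (TangentSpace I x →L[ℝ] ℝ)) := by
      rw [injective_iff_map_eq_zero]
      intro v hv
      by_contra hne
      have h0 : g.inner x v v = 0 := congrArg (fun α : TangentSpace I x →L[ℝ] ℝ ↦ α v) hv
      exact absurd h0 (g.pos x v hne).ne'
    let e : (TangentSpace I x →ₗ[ℝ] ℝ) ≃ₗ[ℝ] (TangentSpace I x →L[ℝ] ℝ) :=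
      LinearMap.toContinuousLinearMap
    have hfin : FiniteDimensional ℝ (TangentSpace I x →L[ℝ] ℝ) := e.finiteDimensional
    refine ⟨hinj, (LinearMap.injective_iff_surjective_of_finrank_eq_finrank ?_).1 hinj⟩
    rw [← e.finrank_eq]
    exact Subspace.dual_finrank_eq.symm)

theorem inner_flat_symm (x : M) (α : TangentSpace I x →L[ℝ] ℝ) (v : TangentSpace I x) :
    g.inner x ((flat g x).symm α) v = α v :=
  congrArg (fun β : TangentSpace I x →L[ℝ] ℝ ↦ β v) ((flat g x).apply_symm_apply α)

/-- The Levi-Civita connection of `g`; `leviCivita g Y x v` is `(D_v Y)(x)`. It is torsion-free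
(`leviCivita_torsion`) and compatible with the metric (`leviCivita_metric`). -/
def leviCivita : CovariantDerivative I E (TangentSpace I : M → Type _) where
  toFun Y x := LinearMap.toContinuousLinearMap ((flat g x).symm.toLinearMap ∘ₗ
    (koszulForm g Y x : TangentSpace I x →ₗ[ℝ] (TangentSpace I x →L[ℝ] ℝ)))
  isCovariantDerivativeOnUniv :=
    { add := by
        intro Y Y' x hY hY' _
        ext1 u
        apply (flat g x).injective
        ext v
        have hu : MDiffAt (T% (extend E u)) x := mdifferentiableAt_extend I E u
        have hv : MDiffAt (T% (extend E v)) x := mdifferentiableAt_extend I E v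
        have h := koszul_add_middle g hu hY hY' hv
        simp [koszulForm_apply' g hY, koszulForm_apply' g hY',
          koszulForm_apply' g (mdifferentiableAt_add_section hY hY'), h]
      leibniz := by
        intro Y f x hY hf _
        ext1 u
        apply (flat g x).injective
        ext v
        have hu : MDiffAt (T% (extend E u)) x := mdifferentiableAt_extend I E u
        have hv : MDiffAt (T% (extend E v)) x := mdifferentiableAt_extend I E v
        have h := koszul_smul_middle g hu hf hY hv
        have h2 : flat g x (Y x) v = g.inner x (Y x) v := rfl
        simp [koszulForm_apply' g hY, h2,
          koszulForm_apply' g (hf.smul_section hY), h] }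

theorem inner_leviCivita (hX : MDiffAt (T% X) x) (hY : MDiffAt (T% Y) x)
    (hZ : MDiffAt (T% Z) x) :
    g.inner x (leviCivita g Y x (X x)) (Z x) = koszul g X Y Z x := by
  rw [← koszulForm_apply g hX hY hZ]
  exact inner_flat_symm g x _ _

theorem leviCivita_torsion : (leviCivita g).torsion = 0 := by
  rw [CovariantDerivative.torsion_eq_zero_iff]
  intro X Y x hX hY
  apply (flat g x).injective
  ext v
  have hv : MDiffAt (T% (extend E v)) x := mdifferentiableAt_extend I E v
  have h1 := inner_leviCivita g hX hY hv
  have h2 := inner_leviCivita g hY hX hv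
  have h3 (X Y : Π x : M, TangentSpace I x) :
      (fun y ↦ g.inner y (X y) (Y y)) = fun y ↦ g.inner y (Y y) (X y) := by
    ext y; exact g.symm y _ _
  simp only [koszul, extend_apply_self] at h1 h2
  change g.inner x _ v = g.inner x _ v
  rw [map_sub, sub_apply, h1, h2, h3 Y X,
    VectorField.mlieBracket_swap_apply (V := Y) (W := X)]
  simp
  ring

theorem leviCivita_metric (hX : MDiffAt (T% X) x) (hY : MDiffAt (T% Y) x)
    (hZ : MDiffAt (T% Z) x) :
    mvfderiv I (fun y ↦ g.inner y (Y y) (Z y)) x (X x) =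
      g.inner x (leviCivita g Y x (X x)) (Z x) + g.inner x (Y x) (leviCivita g Z x (X x)) := by
  have h3 (X Y : Π x : M, TangentSpace I x) :
      (fun y ↦ g.inner y (X y) (Y y)) = fun y ↦ g.inner y (Y y) (X y) := by
    ext y; exact g.symm y _ _
  rw [g.symm x (Y x), inner_leviCivita g hX hY hZ, inner_leviCivita g hX hZ hY]
  simp only [koszul]
  rw [h3 Z Y, VectorField.mlieBracket_swap_apply (V := Z) (W := Y)]
  simp
  ring


variable (D : CovariantDerivative I E (TangentSpace I : M → Type _))
  {K K' : Π x : M, TangentSpace I x →L[ℝ] ℝ}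
  {L : Π x : M, TangentSpace I x →L[ℝ] TangentSpace I x →L[ℝ] ℝ}

theorem mdifferentiableAt_covector_apply
    (hK : MDifferentiableAt I (I.prod 𝓘(ℝ, E →L[ℝ] ℝ))
      (fun y ↦ TotalSpace.mk' (E →L[ℝ] ℝ) y (K y)) x)
    (hX : MDiffAt (T% X) x) : MDiffAt (fun y ↦ K y (X y)) x := by
  have h : MDifferentiableAt I (I.prod 𝓘(ℝ))
      (fun m ↦ TotalSpace.mk' ℝ (E := Bundle.Trivial M ℝ) m (K m (X m))) x :=
    MDifferentiableAt.clm_bundle_apply (F₁ := E) hK hX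
  rw [mdifferentiableAt_totalSpace] at h
  exact h.2

theorem mdifferentiableAt_bilin_apply
    (hL : MDifferentiableAt I (I.prod 𝓘(ℝ, E →L[ℝ] E →L[ℝ] ℝ))
      (fun y ↦ TotalSpace.mk' (E →L[ℝ] E →L[ℝ] ℝ) y (L y)) x)
    (hX : MDiffAt (T% X) x) :
    MDifferentiableAt I (I.prod 𝓘(ℝ, E →L[ℝ] ℝ))
      (fun y ↦ TotalSpace.mk' (E →L[ℝ] ℝ) y (L y (X y))) x :=
  MDifferentiableAt.clm_bundle_apply (F₁ := E) hL hX

theorem covector_tensorial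
    (hK : MDifferentiableAt I (I.prod 𝓘(ℝ, E →L[ℝ] ℝ))
      (fun y ↦ TotalSpace.mk' (E →L[ℝ] ℝ) y (K y)) x) :
    TensorialAt I E (fun U ↦ mvfderiv I (fun y ↦ K y (U y)) x - (K x).comp (D U x)) x where
  smul {f U} hf hU := by
    have h1 : (fun y ↦ K y ((f • U) y)) = f * fun y ↦ K y (U y) := by
      ext y; simp
    rw [h1, mvfderiv_mul hf (mdifferentiableAt_covector_apply hK hU),
      D.isCovariantDerivativeOnUniv.leibniz hU hf]
    ext v
    simp
    ring
  add {U U'} hU hU' := by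
    have h1 : (fun y ↦ K y ((U + U') y)) = (fun y ↦ K y (U y)) + fun y ↦ K y (U' y) := by
      ext y; simp
    rw [h1, mvfderiv_add (mdifferentiableAt_covector_apply hK hU)
      (mdifferentiableAt_covector_apply hK hU'), D.isCovariantDerivativeOnUniv.add hU hU']
    ext v
    simp
    ring

/-- Exchange of the two arguments of a bilinear map on the tangent space. -/
def swap {F : Type*} [AddCommGroup F] [Module ℝ F] [TopologicalSpace F]
    [IsTopologicalAddGroup F] [ContinuousSMul ℝ F] {x : M}
    (B : TangentSpace I x →L[ℝ] TangentSpace I x →L[ℝ] F) :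
    TangentSpace I x →L[ℝ] TangentSpace I x →L[ℝ] F :=
  (LinearMap.mk₂ ℝ (fun u v ↦ B v u) (by simp) (by simp) (by simp) (by simp)
    ).toContinuousBilinearMap

@[simp] theorem swap_apply {F : Type*} [AddCommGroup F] [Module ℝ F] [TopologicalSpace F]
    [IsTopologicalAddGroup F] [ContinuousSMul ℝ F] {x : M}
    (B : TangentSpace I x →L[ℝ] TangentSpace I x →L[ℝ] F) (u v : TangentSpace I x) :
    swap B u v = B v u := rfl

open Classical in
/-- Covariant derivative of a covector field: `covectorDeriv D K x v a` is `(D_v K)(a)`, that is,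
`v (K(A)) - K(D_v A)` for any vector field `A` with `A x = a` (see `covectorDeriv_apply`). In index
notation this is `K_{a;b}` with `b = v`. It is `0` where `K` is not differentiable. -/
def covectorDeriv (K : Π x : M, TangentSpace I x →L[ℝ] ℝ) (x : M) :
    TangentSpace I x →L[ℝ] TangentSpace I x →L[ℝ] ℝ :=
  if hK : MDifferentiableAt I (I.prod 𝓘(ℝ, E →L[ℝ] ℝ))
      (fun y ↦ TotalSpace.mk' (E →L[ℝ] ℝ) y (K y)) x then
    swap (TensorialAt.mkHom (fun U ↦ mvfderiv I (fun y ↦ K y (U y)) x - (K x).comp (D U x)) x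
      (covector_tensorial D hK))
  else 0

theorem covectorDeriv_apply
    (hK : MDifferentiableAt I (I.prod 𝓘(ℝ, E →L[ℝ] ℝ))
      (fun y ↦ TotalSpace.mk' (E →L[ℝ] ℝ) y (K y)) x) (hX : MDiffAt (T% X) x)
    (v : TangentSpace I x) :
    covectorDeriv D K x v (X x) = mvfderiv I (fun y ↦ K y (X y)) x v - K x (D X x v) := by
  rw [covectorDeriv, dif_pos hK]
  exact congrArg (fun α : TangentSpace I x →L[ℝ] ℝ ↦ α v)
    (TensorialAt.mkHom_apply (covector_tensorial D hK) hX)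

theorem bilin_tensorial
    (hL : MDifferentiableAt I (I.prod 𝓘(ℝ, E →L[ℝ] E →L[ℝ] ℝ))
      (fun y ↦ TotalSpace.mk' (E →L[ℝ] E →L[ℝ] ℝ) y (L y)) x) :
    TensorialAt I E (fun U ↦ covectorDeriv D (fun y ↦ L y (U y)) x - (L x).comp (D U x)) x where
  smul {f U} hf hU := by
    rw [D.isCovariantDerivativeOnUniv.leibniz hU hf]
    ext v w
    have hw : MDiffAt (T% (extend E w)) x := mdifferentiableAt_extend I E w
    have h0 := covectorDeriv_apply D (mdifferentiableAt_bilin_apply hL hU) hw v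
    have h1 := covectorDeriv_apply D (mdifferentiableAt_bilin_apply hL (hf.smul_section hU)) hw v
    have h2 : (fun y ↦ L y ((f • U) y) (extend E w y)) = f * fun y ↦ L y (U y) (extend E w y) := by
      ext y; simp
    rw [h2, mvfderiv_mul hf
      (mdifferentiableAt_covector_apply (mdifferentiableAt_bilin_apply hL hU) hw)] at h1
    simp only [extend_apply_self] at h0 h1
    simp at h1 ⊢
    rw [h1, h0]
    ring
  add {U U'} hU hU' := by
    rw [D.isCovariantDerivativeOnUniv.add hU hU']
    ext v w
    have hw : MDiffAt (T% (extend E w)) x := mdifferentiableAt_extend I E w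
    have h0 := covectorDeriv_apply D (mdifferentiableAt_bilin_apply hL hU) hw v
    have h0' := covectorDeriv_apply D (mdifferentiableAt_bilin_apply hL hU') hw v
    have h1 := covectorDeriv_apply D
      (mdifferentiableAt_bilin_apply hL (mdifferentiableAt_add_section hU hU')) hw v
    have h2 : (fun y ↦ L y ((U + U') y) (extend E w y)) =
        (fun y ↦ L y (U y) (extend E w y)) + fun y ↦ L y (U' y) (extend E w y) := by
      ext y; simp
    rw [h2, mvfderiv_add
      (mdifferentiableAt_covector_apply (mdifferentiableAt_bilin_apply hL hU) hw)
      (mdifferentiableAt_covector_apply (mdifferentiableAt_bilin_apply hL hU') hw)] at h1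
    simp only [extend_apply_self] at h0 h0' h1
    simp at h1 ⊢
    linarith

open Classical in
/-- Covariant derivative of a field of bilinear forms: `bilinDeriv D L x v a b` is `(D_v L)(a, b)`,
that is, `v (L(A, B)) - L(D_v A, B) - L(A, D_v B)` (see `bilinDeriv_apply`). It is `0` where `L` is
not differentiable. -/
def bilinDeriv (L : Π x : M, TangentSpace I x →L[ℝ] TangentSpace I x →L[ℝ] ℝ) (x : M) :
    TangentSpace I x →L[ℝ] TangentSpace I x →L[ℝ] TangentSpace I x →L[ℝ] ℝ :=
  if hL : MDifferentiableAt I (I.prod 𝓘(ℝ, E →L[ℝ] E →L[ℝ] ℝ))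
      (fun y ↦ TotalSpace.mk' (E →L[ℝ] E →L[ℝ] ℝ) y (L y)) x then
    swap (TensorialAt.mkHom (fun U ↦ covectorDeriv D (fun y ↦ L y (U y)) x - (L x).comp (D U x)) x
      (bilin_tensorial D hL))
  else 0

theorem bilinDeriv_apply
    (hL : MDifferentiableAt I (I.prod 𝓘(ℝ, E →L[ℝ] E →L[ℝ] ℝ))
      (fun y ↦ TotalSpace.mk' (E →L[ℝ] E →L[ℝ] ℝ) y (L y)) x) (hX : MDiffAt (T% X) x)
    (hY : MDiffAt (T% Y) x) (v : TangentSpace I x) :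
    bilinDeriv D L x v (X x) (Y x) =
      mvfderiv I (fun y ↦ L y (X y) (Y y)) x v - L x (D X x v) (Y x) - L x (X x) (D Y x v) := by
  have h := congrArg (fun α : TangentSpace I x →L[ℝ] TangentSpace I x →L[ℝ] ℝ ↦ α v (Y x))
    (TensorialAt.mkHom_apply (bilin_tensorial D hL) hX)
  rw [bilinDeriv, dif_pos hL]
  refine h.trans ?_
  simp [covectorDeriv_apply D (mdifferentiableAt_bilin_apply hL hX) hY v]
  ring

/-- The curvature of a connection `∇` on a bundle with fibres `V x`, evaluated on vector fields
`X`, `Y` and a section `σ`: `∇_X ∇_Y σ - ∇_Y ∇_X σ - ∇_{[X, Y]} σ`. -/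
def curvatureField {V : M → Type*} [∀ x, AddCommGroup (V x)]
    (cov : (Π x, V x) → Π x, TangentSpace I x → V x) (X Y : Π x : M, TangentSpace I x)
    (σ : Π x, V x) (x : M) : V x :=
  cov (fun y ↦ cov σ y (Y y)) x (X x) - cov (fun y ↦ cov σ y (X y)) x (Y x)
    - cov σ x (VectorField.mlieBracket I X Y x)

/-- The Riemann curvature tensor `riemann g x u v w = R(u, v) w`, given by its components
`R(∂ᵢ, ∂ⱼ) ∂ₖ` with respect to a frame of coordinate vector fields around `x` (`extend E` extends a
tangent vector at `x` with constant components in the preferred chart at `x`). -/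
def riemann (x : M) : TangentSpace I x →L[ℝ] TangentSpace I x →L[ℝ] TangentSpace I x →L[ℝ]
    TangentSpace I x :=
  let b := Module.finBasis ℝ (TangentSpace I x)
  let c := fun i ↦ LinearMap.toContinuousLinearMap (b.coord i)
  ∑ i, ∑ j, ∑ k, (c i).smulRight ((c j).smulRight ((c k).smulRight
    (curvatureField (fun σ y v ↦ leviCivita g σ y v)
      (extend E (b i)) (extend E (b j)) (extend E (b k)) x)))

variable (I) in
/-- The fibre at `x` of `T*M ⊕ (T*M ⊗ T*M)`. The bundle `W = T*M ⊕ Λ²T*M` is the subbundle of pairs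
`(K, L)` with `L` alternating, see `InW`. -/
abbrev WFiber (x : M) : Type _ :=
  (TangentSpace I x →L[ℝ] ℝ) × (TangentSpace I x →L[ℝ] TangentSpace I x →L[ℝ] ℝ)

/-- `w = (K, L)` lies in `W = T*M ⊕ Λ²T*M`. -/
def InW (x : M) (w : WFiber I x) : Prop := ∀ v, w.2 v v = 0

/-- Smoothness on `U` of both components of `s`. -/
def SmoothWSectionOn (s : Π x : M, WFiber I x) (U : Set M) : Prop :=
  ContMDiffOn I (I.prod 𝓘(ℝ, E →L[ℝ] ℝ)) ∞
    (fun y ↦ TotalSpace.mk' (E →L[ℝ] ℝ) y (s y).1) U ∧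
  ContMDiffOn I (I.prod 𝓘(ℝ, E →L[ℝ] E →L[ℝ] ℝ)) ∞
    (fun y ↦ TotalSpace.mk' (E →L[ℝ] E →L[ℝ] ℝ) y (s y).2) U

/-- The form `(a, b) ↦ R_{abv}{}^c K_c`, with the convention
`A_{c;ba} - A_{c;ab} = R_{abc}{}^d A_d`, so that `R_{abc}{}^d K_d = -K(R(a, b) c)`. -/
def curvatureTerm (K : Π x : M, TangentSpace I x →L[ℝ] ℝ) (x : M) (v : TangentSpace I x) :
    TangentSpace I x →L[ℝ] TangentSpace I x →L[ℝ] ℝ :=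
  (LinearMap.mk₂ ℝ (fun a b ↦ - K x (riemann g x a b v))
    
    (fun a a' b ↦ by
      rw [ContinuousLinearMap.map_add, add_apply, add_apply, ContinuousLinearMap.map_add]; ring)
    (fun r a b ↦ by
      rw [ContinuousLinearMap.map_smul, smul_apply, smul_apply, ContinuousLinearMap.map_smul,
        smul_neg])
    (fun a b b' ↦ by
      rw [ContinuousLinearMap.map_add, add_apply, ContinuousLinearMap.map_add]; ring)
    (fun r a b ↦ by
      rw [ContinuousLinearMap.map_smul, smul_apply, ContinuousLinearMap.map_smul, smul_neg])).toContinuousBilinearMap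

/-- The connection `∇_v (K, L) = (K_{a;v} - L_{av}, L_{ab;v} - R_{abv}{}^c K_c)` on `W`, whose parallel
sections correspond to Killing fields. -/
def wConnection (s : Π x : M, WFiber I x) (x : M) (v : TangentSpace I x) : WFiber I x :=
  (covectorDeriv (leviCivita g) (fun y ↦ (s y).1) x v - swap (s x).2 v,
   bilinDeriv (leviCivita g) (fun y ↦ (s y).2) x v - curvatureTerm g (fun y ↦ (s y).1) x v)

/-- `s` is a smooth section over the open set `U` of the subset `V` of the bundle. -/
def IsLocalSection (V : Π x : M, Set (WFiber I x)) (U : Set M) (s : Π x : M, WFiber I x) : Prop :=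
  IsOpen U ∧ SmoothWSectionOn s U ∧ ∀ y ∈ U, s y ∈ V y

/-- The kernel `V⁽⁰⁾ ⊆ W` of the curvature `F` of `∇`. As `F` is tensorial, `F(·,·)(w)` is computed
from any local section of `W` through `w` and any smooth vector fields. -/
def curvatureKernel (x : M) : Set (WFiber I x) :=
  {w | ∃ (U : Set M) (s : Π y : M, WFiber I y), x ∈ U ∧
    IsLocalSection (fun y ↦ {w : WFiber I y | InW y w}) U s ∧ s x = w ∧
    ∀ A B : Π y : M, TangentSpace I y, CMDiffAt ∞ (T% A) x → CMDiffAt ∞ (T% B) x →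
      curvatureField (wConnection g) A B s x = 0}

/-- The leveling map `𝒮`: the elements of `V` that lie on a smooth local section of `V`. -/
def level (V : Π x : M, Set (WFiber I x)) (x : M) : Set (WFiber I x) :=
  {w | ∃ (U : Set M) (s : Π y : M, WFiber I y), x ∈ U ∧ IsLocalSection V U s ∧ s x = w}

/-- The kernel of `α : W' → (W / W') ⊗ T*M`, `α(w) = ∇s(x) mod W'` where `s` is any smooth local
section of `W'` with `s x = w`. -/
def alphaKernel (W' : Π x : M, Set (WFiber I x)) (x : M) : Set (WFiber I x) :=
  {w | ∃ (U : Set M) (s : Π y : M, WFiber I y), x ∈ U ∧ IsLocalSection W' U s ∧ s x = w ∧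
    ∀ v : TangentSpace I x, wConnection g s x v ∈ W' x}

/-- The subsets `V⁽ⁱ⁾` of the derived flag: `V⁽⁰⁾ = ker F` and `V⁽ⁱ⁺¹⁾ = ker α_{W⁽ⁱ⁾}`. -/
def flagV : ℕ → Π x : M, Set (WFiber I x)
  | 0 => curvatureKernel g
  | i + 1 => alphaKernel g (level (flagV i))

/-- The subsets `W⁽ⁱ⁾ = 𝒮(V⁽ⁱ⁾)` of the derived flag. -/
def flagW (i : ℕ) : Π x : M, Set (WFiber I x) := level (flagV g i)

/-- The fibres of `V` are linear subspaces of the same dimension `r`. -/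
def HasRank (V : Π x : M, Set (WFiber I x)) (r : ℕ) : Prop :=
  ∀ x, ∃ S : Submodule ℝ (WFiber I x), (S : Set (WFiber I x)) = V x ∧ Module.finrank ℝ S = r

/-- Regularity: `W⁽ⁱ⁾ = V⁽ⁱ⁾` has constant rank for all `i`. -/
def IsRegular : Prop := ∀ i : ℕ, flagW g i = flagV g i ∧ ∃ r : ℕ, HasRank (flagW g i) r

/-- A smooth covector field `K` on `M` is a Killing field if `K_{a;b} + K_{b;a} = 0`. -/
def IsKillingField (K : Π x : M, TangentSpace I x →L[ℝ] ℝ) : Prop :=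
  ContMDiff I (I.prod 𝓘(ℝ, E →L[ℝ] ℝ)) ∞ (fun y ↦ TotalSpace.mk' (E →L[ℝ] ℝ) y (K y)) ∧
  ∀ (x : M) (a b : TangentSpace I x),
    covectorDeriv (leviCivita g) K x b a + covectorDeriv (leviCivita g) K x a b = 0

/-- The sectional curvature of the plane spanned by `u` and `v`. -/
def sectionalCurvature (x : M) (u v : TangentSpace I x) : ℝ :=
  g.inner x (riemann g x u v v) u /
    (g.inner x u u * g.inner x v v - g.inner x u v ^ 2)

/-- The gradient of `f`, the vector field `f^{,a}` dual to `df`. -/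
def gradient (f : M → ℝ) (x : M) : TangentSpace I x := (flat g x).symm (mvfderiv I f x)

/-- The wedge product of two covectors, `(α ∧ β)(u, v) = α(u) β(v) - α(v) β(u)`. -/
def wedge {x : M} (α β : TangentSpace I x →L[ℝ] ℝ) :
    TangentSpace I x →L[ℝ] TangentSpace I x →L[ℝ] ℝ :=
  α.smulRight β - β.smulRight α

end

/-- The Gaussian curvature of a surface: the sectional curvature of the whole tangent plane. -/
def gaussianCurvature {M : Type*} [TopologicalSpace M] [ChartedSpace (EuclideanSpace ℝ (Fin 2)) M]
    [IsManifold (𝓡 2) ∞ M]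
    (g : ContMDiffRiemannianMetric (𝓡 2) ∞ (EuclideanSpace ℝ (Fin 2))
      (TangentSpace (𝓡 2) : M → Type _)) (x : M) : ℝ :=
  sectionalCurvature g x (EuclideanSpace.single (0 : Fin 2) (1 : ℝ) : EuclideanSpace ℝ (Fin 2))
    (EuclideanSpace.single (1 : Fin 2) (1 : ℝ) : EuclideanSpace ℝ (Fin 2))

end RiemannianGeometry
end

/-! Let `K` be a Killing field. Its prolongation `(K, DK)` is a parallel section of `W`, so the
curvature `F` annihilates it, and it lies in `V⁽⁰⁾`, in `W⁽⁰⁾` and, its derivative being zero, in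
`V⁽¹⁾`. It is nonzero wherever `K` is. Regularity makes the rank of `V⁽¹⁾` constant, hence `V⁽¹⁾`
has a nonzero element over every point `x`, although this element need not come from `K`.

On a surface the Λ² component of `F(e₁, e₂)(k, L)` is `k(∂c)`, so elements of `V⁽⁰⁾` satisfy `k(∂c)
= 0`. A nonzero `w ∈ V⁽¹⁾` over `x` extends to a local section `s = (k, L)` of `W⁽⁰⁾ ⊆ V⁽⁰⁾` with
`∇s(x)` again in `V⁽⁰⁾`. Differentiate `k(∂c) = 0` in a direction `v` at `x`. The first component
`D_v k - L(·, v)` of `∇_v s` annihilates `∂c`, so what remains is `L(∂c, v) + k(D_v ∂c) = 0`. For `v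
= ∂c` the first term vanishes, as `L` is alternating, and `k(D_{∂c} ∂c) = 0`. If `∂c ≠ 0` at `x`,
then `k ≠ 0`: otherwise `L(∂c, ·) = 0`, which forces `L = 0` in dimension two and `w = 0`. So `∂c`
and `D_{∂c} ∂c` lie in the same line `ker k` and are proportional. If `∂c = 0` there is nothing to
prove.

The computations use a local orthonormal frame, in which the Levi-Civita connection is one 1-form
`ω` with `dω = -c e¹ ∧ e²`, and a section of `W` is three functions `k₁, k₂, l`. The argument rests
on `curvatureField_wConnection` (the curvature of `∇`), `wConnection_prolongation` (Killing fields
are parallel), `IsRegular.exists_ne_zero` (use of regularity) and `hessian_parallel` (the pointwise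
algebra). -/

noncomputable section

set_option linter.unusedSectionVars false

namespace RiemannianGeometry

/-! ### Directional derivatives and Lie brackets of smooth vector fields -/

section
variable {E : Type*} [NormedAddCommGroup E] [NormedSpace ℝ E] [FiniteDimensional ℝ E]
  {H : Type*} [TopologicalSpace H] {I : ModelWithCorners ℝ E H}
  {M : Type*} [TopologicalSpace M] [ChartedSpace H M] [IsManifold I ∞ M]
  (g : ContMDiffRiemannianMetric I ∞ E (TangentSpace I : M → Type _))
  {X Y Z : Π x : M, TangentSpace I x} {U : Set M} {x y : M}

/-- The derivative of the function `f` in the direction of the vector field `X`. -/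
def dirDeriv (X : Π x : M, TangentSpace I x) (f : M → ℝ) (x : M) : ℝ := mvfderiv I f x (X x)

theorem mvfderiv_congr {f f' : M → ℝ} (h : f =ᶠ[𝓝 x] f') :
    mvfderiv I f x = mvfderiv I f' x := by
  have := h.mfderiv_eq (I := I) (I' := 𝓘(ℝ))
  have h0 := h.eq_of_nhds
  ext v
  simp only [mvfderiv]
  rw [this]
  rfl

theorem contMDiffOn_inner (hX : CMDiff[U] ∞ (T% X)) (hY : CMDiff[U] ∞ (T% Y)) :
    CMDiff[U] ∞ (fun y ↦ g.inner y (X y) (Y y)) := by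
  intro x hx
  have h : ContMDiffWithinAt I (I.prod 𝓘(ℝ)) ∞
      (fun m ↦ TotalSpace.mk' ℝ (E := Bundle.Trivial M ℝ) m (g.inner m (X m) (Y m))) U x := by
    apply ContMDiffWithinAt.clm_bundle_apply₂ (F₁ := E) (F₂ := E)
    · exact g.contMDiff.contMDiffAt.contMDiffWithinAt
    · exact hX x hx
    · exact hY x hx
  rw [contMDiffWithinAt_totalSpace] at h
  exact h.2

theorem contMDiffOn_covector_apply {K : Π x : M, TangentSpace I x →L[ℝ] ℝ}
    (hK : ContMDiffOn I (I.prod 𝓘(ℝ, E →L[ℝ] ℝ)) ∞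
      (fun y ↦ TotalSpace.mk' (E →L[ℝ] ℝ) y (K y)) U)
    (hX : CMDiff[U] ∞ (T% X)) : CMDiff[U] ∞ (fun y ↦ K y (X y)) := by
  intro x hx
  have h : ContMDiffWithinAt I (I.prod 𝓘(ℝ)) ∞
      (fun m ↦ TotalSpace.mk' ℝ (E := Bundle.Trivial M ℝ) m (K m (X m))) U x :=
    ContMDiffWithinAt.clm_bundle_apply (F₁ := E) (hK x hx) (hX x hx)
  rw [contMDiffWithinAt_totalSpace] at h
  exact h.2

theorem contMDiffOn_bilin_apply {L : Π x : M, TangentSpace I x →L[ℝ] TangentSpace I x →L[ℝ] ℝ}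
    (hL : ContMDiffOn I (I.prod 𝓘(ℝ, E →L[ℝ] E →L[ℝ] ℝ)) ∞
      (fun y ↦ TotalSpace.mk' (E →L[ℝ] E →L[ℝ] ℝ) y (L y)) U)
    (hX : CMDiff[U] ∞ (T% X)) :
    ContMDiffOn I (I.prod 𝓘(ℝ, E →L[ℝ] ℝ)) ∞
      (fun y ↦ TotalSpace.mk' (E →L[ℝ] ℝ) y (L y (X y))) U :=
  fun x hx ↦ ContMDiffWithinAt.clm_bundle_apply (F₁ := E) (hL x hx) (hX x hx)

theorem contMDiffOn_mlieBracket (hU : IsOpen U) (hX : CMDiff[U] ∞ (T% X))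
    (hY : CMDiff[U] ∞ (T% Y)) : CMDiff[U] ∞ (T% (VectorField.mlieBracket I X Y)) := by
  have : CompleteSpace E := FiniteDimensional.complete ℝ E
  have : IsManifold I ((((⊤ : ℕ∞)) : ℕ∞ω) + 1) M := ‹IsManifold I ∞ M›
  have : IsManifold I (minSmoothness ℝ 2) M := by
    have h : minSmoothness ℝ 2 ≤ ∞ := by simp; exact ENat.LEInfty.out
    exact IsManifold.of_le h
  intro x hx
  refine ContMDiffAt.contMDiffWithinAt ?_
  exact ContMDiffAt.mlieBracket_vectorField (n := ⊤) (m := ⊤)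
    ((hX x hx).contMDiffAt (hU.mem_nhds hx)) ((hY x hx).contMDiffAt (hU.mem_nhds hx)) (by simp)

theorem mdiffAt_of_contMDiffOn {F : Type*} [NormedAddCommGroup F] [NormedSpace ℝ F] {H' : Type*}
    [TopologicalSpace H'] {J : ModelWithCorners ℝ F H'} {N : Type*} [TopologicalSpace N]
    [ChartedSpace H' N] {f : M → N} (hU : IsOpen U) (hf : ContMDiffOn I J ∞ f U) (hx : x ∈ U) :
    MDifferentiableAt I J f x :=
  ((hf x hx).contMDiffAt (hU.mem_nhds hx)).mdifferentiableAt (by simp)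

variable {f f' : M → ℝ}

theorem dirDeriv_congr (hU : IsOpen U) (h : ∀ y ∈ U, f y = f' y) (hx : x ∈ U) :
    dirDeriv X f x = dirDeriv X f' x := by
  rw [dirDeriv, dirDeriv, mvfderiv_congr (Filter.eventuallyEq_of_mem (hU.mem_nhds hx) h)]

theorem dirDeriv_add (hf : MDiffAt f x) (hf' : MDiffAt f' x) :
    dirDeriv X (fun y ↦ f y + f' y) x = dirDeriv X f x + dirDeriv X f' x := by
  simp [dirDeriv, mvfderiv_fun_add hf hf']

theorem dirDeriv_sub (hf : MDiffAt f x) (hf' : MDiffAt f' x) :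
    dirDeriv X (fun y ↦ f y - f' y) x = dirDeriv X f x - dirDeriv X f' x := by
  simp [dirDeriv, mvfderiv_fun_sub hf hf']

theorem dirDeriv_neg : dirDeriv X (fun y ↦ - f y) x = - dirDeriv X f x := by
  simp [dirDeriv, mvfderiv_fun_neg]

theorem dirDeriv_mul (hf : MDiffAt f x) (hf' : MDiffAt f' x) :
    dirDeriv X (fun y ↦ f y * f' y) x = f x * dirDeriv X f' x + f' x * dirDeriv X f x := by
  simp [dirDeriv, mvfderiv_fun_mul hf hf']

theorem dirDeriv_const (c : ℝ) : dirDeriv X (fun _ ↦ c) x = 0 := by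
  simp [dirDeriv, mvfderiv_const]

theorem contMDiffOn_mul (hf : CMDiff[U] ∞ f) (hf' : CMDiff[U] ∞ f') :
    CMDiff[U] ∞ (fun y ↦ f y * f' y) := hf.mul hf'

/-- `X f` is smooth, as `X f = g([X, f e] - f [X, e], e)` for a unit vector field `e`. -/
theorem contMDiffOn_dirDeriv_of_unit {e : Π x : M, TangentSpace I x} (hU : IsOpen U)
    (he : CMDiff[U] ∞ (T% e)) (he1 : ∀ y ∈ U, g.inner y (e y) (e y) = 1)
    (hX : CMDiff[U] ∞ (T% X)) (hf : CMDiff[U] ∞ f) : CMDiff[U] ∞ (dirDeriv X f) := by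
  have h1 := (contMDiffOn_mlieBracket hU hX (hf.smul_section he)).sub_section
    (hf.smul_section (contMDiffOn_mlieBracket hU hX he))
  refine (contMDiffOn_inner g h1 he).congr fun y hy ↦ ?_
  simp only [Pi.sub_apply]
  rw [VectorField.mlieBracket_smul_right (mdiffAt_of_contMDiffOn hU hf hy)
    (mdiffAt_of_contMDiffOn hU he hy)]
  simp [he1 y hy, dirDeriv]

/-- Apply the Jacobi identity to `X`, `Y` and `f e`. Expanding by the Leibniz rule, the mixed terms
cancel and the terms with `f` undifferentiated are the Jacobi identity for `X, Y, e`. The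
coefficient of `e` is the claim, read off by pairing with the unit field `e`. -/
theorem dirDeriv_mlieBracket_of_unit {e : Π x : M, TangentSpace I x} (hU : IsOpen U)
    (he : CMDiff[U] ∞ (T% e)) (he1 : ∀ y ∈ U, g.inner y (e y) (e y) = 1)
    (hX : CMDiff[U] ∞ (T% X)) (hY : CMDiff[U] ∞ (T% Y)) (hf : CMDiff[U] ∞ f) (hx : x ∈ U) :
    dirDeriv (VectorField.mlieBracket I X Y) f x =
      dirDeriv X (dirDeriv Y f) x - dirDeriv Y (dirDeriv X f) x := by
  have : CompleteSpace E := FiniteDimensional.complete ℝ E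
  have : IsManifold I (minSmoothness ℝ 3) M := by
    have h : minSmoothness ℝ 3 ≤ ∞ := by simp; exact ENat.LEInfty.out
    exact IsManifold.of_le h
  have h2 : minSmoothness ℝ 2 ≤ ∞ := by simp; exact ENat.LEInfty.out
  have at' : ∀ {V : Π x : M, TangentSpace I x}, CMDiff[U] ∞ (T% V) →
      CMDiffAt (minSmoothness ℝ 2) (T% V) x := fun hV ↦
    ((hV x hx).contMDiffAt (hU.mem_nhds hx)).of_le h2
  have key : ∀ {V W : Π x : M, TangentSpace I x}, CMDiff[U] ∞ (T% V) → CMDiff[U] ∞ (T% W) →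
      VectorField.mlieBracket I V (VectorField.mlieBracket I W (f • e)) x =
      dirDeriv V (dirDeriv W f) x • e x + dirDeriv W f x • VectorField.mlieBracket I V e x
      + dirDeriv V f x • VectorField.mlieBracket I W e x
      + f x • VectorField.mlieBracket I V (VectorField.mlieBracket I W e) x := by
    intro V W hV hW
    have hWf := contMDiffOn_dirDeriv_of_unit g hU he he1 hW hf
    have hWe := contMDiffOn_mlieBracket hU hW he
    have heq : VectorField.mlieBracket I W (f • e) =ᶠ[𝓝 x]
        dirDeriv W f • e + f • VectorField.mlieBracket I W e := by
      filter_upwards [hU.mem_nhds hx] with y hy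
      rw [VectorField.mlieBracket_smul_right (mdiffAt_of_contMDiffOn hU hf hy)
        (mdiffAt_of_contMDiffOn hU he hy)]
      rfl
    refine (Filter.EventuallyEq.mlieBracket_vectorField_eq (Filter.EventuallyEq.refl _ V)
      heq).trans ?_
    rw [VectorField.mlieBracket_add_right
        (mdiffAt_of_contMDiffOn hU (hWf.smul_section he) hx)
        (mdiffAt_of_contMDiffOn hU (hf.smul_section hWe) hx),
      VectorField.mlieBracket_smul_right (mdiffAt_of_contMDiffOn hU hWf hx)
        (mdiffAt_of_contMDiffOn hU he hx),
      VectorField.mlieBracket_smul_right (mdiffAt_of_contMDiffOn hU hf hx)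
        (mdiffAt_of_contMDiffOn hU hWe hx)]
    simp only [dirDeriv]
    abel
  have jac := VectorField.leibniz_identity_mlieBracket_apply (at' hX) (at' hY)
    (at' (hf.smul_section he))
  have jac' := VectorField.leibniz_identity_mlieBracket_apply (at' hX) (at' hY) (at' he)
  rw [key hX hY, key hY hX, VectorField.mlieBracket_smul_right (mdiffAt_of_contMDiffOn hU hf hx)
    (mdiffAt_of_contMDiffOn hU he hx), jac'] at jac
  have h := congrArg (fun v ↦ g.inner x v (e x)) jac
  simp [he1 x hx] at h
  simp only [dirDeriv] at h ⊢
  linarith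

end

/-! ### Orthonormal frames: connection form and curvature of a surface -/

section
variable {E : Type*} [NormedAddCommGroup E] [NormedSpace ℝ E] [FiniteDimensional ℝ E]
  {H : Type*} [TopologicalSpace H] {I : ModelWithCorners ℝ E H}
  {M : Type*} [TopologicalSpace M] [ChartedSpace H M] [IsManifold I ∞ M]
  {g : ContMDiffRiemannianMetric I ∞ E (TangentSpace I : M → Type _)}
  {e₁ e₂ X Y Z : Π x : M, TangentSpace I x} {U : Set M} {x y : M} {f f' : M → ℝ}

variable (g e₁ e₂ U) in
/-- `e₁`, `e₂` is a smooth orthonormal frame of the tangent bundle of a surface over the open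
set `U`. -/
structure IsOrthonormalFrameOn : Prop where
  isOpen : IsOpen U
  smooth₁ : CMDiff[U] ∞ (T% e₁)
  smooth₂ : CMDiff[U] ∞ (T% e₂)
  inner₁₁ : ∀ y ∈ U, g.inner y (e₁ y) (e₁ y) = 1
  inner₁₂ : ∀ y ∈ U, g.inner y (e₁ y) (e₂ y) = 0
  inner₂₂ : ∀ y ∈ U, g.inner y (e₂ y) (e₂ y) = 1
  -- Spanning is what encodes dimension two in the frame computations.
  decomp : ∀ y ∈ U, ∀ v, v = g.inner y v (e₁ y) • e₁ y + g.inner y v (e₂ y) • e₂ y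

variable (g e₁ e₂) in
/-- The connection form `v ↦ g(D_v e₁, e₂)` of a frame. -/
def connForm (y : M) (v : TangentSpace I y) : ℝ := g.inner y (leviCivita g e₁ y v) (e₂ y)

variable (g e₁ e₂) in
/-- The value of the connection form on the first vector of the frame. -/
def conn₁ (y : M) : ℝ := connForm g e₁ e₂ y (e₁ y)

variable (g e₁ e₂) in
/-- The value of the connection form on the second vector of the frame. -/
def conn₂ (y : M) : ℝ := connForm g e₁ e₂ y (e₂ y)

variable (g e₁ e₂) in
/-- The curvature of a surface in terms of the connection form of an orthonormal frame. -/
def frameCurvature (y : M) : ℝ :=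
  dirDeriv e₂ (conn₁ g e₁ e₂) y - dirDeriv e₁ (conn₂ g e₁ e₂) y
    - conn₁ g e₁ e₂ y ^ 2 - conn₂ g e₁ e₂ y ^ 2

namespace IsOrthonormalFrameOn

variable (h : IsOrthonormalFrameOn g e₁ e₂ U)
include h

/-- Local sections of the flag live on open sets of their own, to which the frame has to be
restricted. -/
theorem mono {V : Set M} (hV : IsOpen V) (hVU : V ⊆ U) : IsOrthonormalFrameOn g e₁ e₂ V where
  isOpen := hV
  smooth₁ := h.smooth₁.mono hVU
  smooth₂ := h.smooth₂.mono hVU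
  inner₁₁ y hy := h.inner₁₁ y (hVU hy)
  inner₁₂ y hy := h.inner₁₂ y (hVU hy)
  inner₂₂ y hy := h.inner₂₂ y (hVU hy)
  decomp y hy := h.decomp y (hVU hy)

theorem inner₂₁ (y : M) (hy : y ∈ U) : g.inner y (e₂ y) (e₁ y) = 0 := by
  rw [g.symm]; exact h.inner₁₂ y hy

theorem mdiffAt (hf : CMDiff[U] ∞ f) (hy : y ∈ U) : MDiffAt f y :=
  mdiffAt_of_contMDiffOn h.isOpen hf hy

theorem mdiffAt_field (hX : CMDiff[U] ∞ (T% X)) (hy : y ∈ U) : MDiffAt (T% X) y :=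
  mdiffAt_of_contMDiffOn h.isOpen hX hy

theorem dirDeriv_add (hf : CMDiff[U] ∞ f) (hf' : CMDiff[U] ∞ f') (hy : y ∈ U) :
    dirDeriv X (fun y ↦ f y + f' y) y = dirDeriv X f y + dirDeriv X f' y :=
  RiemannianGeometry.dirDeriv_add (h.mdiffAt hf hy) (h.mdiffAt hf' hy)

theorem dirDeriv_sub (hf : CMDiff[U] ∞ f) (hf' : CMDiff[U] ∞ f') (hy : y ∈ U) :
    dirDeriv X (fun y ↦ f y - f' y) y = dirDeriv X f y - dirDeriv X f' y :=
  RiemannianGeometry.dirDeriv_sub (h.mdiffAt hf hy) (h.mdiffAt hf' hy)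

theorem dirDeriv_mul (hf : CMDiff[U] ∞ f) (hf' : CMDiff[U] ∞ f') (hy : y ∈ U) :
    dirDeriv X (fun y ↦ f y * f' y) y = f y * dirDeriv X f' y + f' y * dirDeriv X f y :=
  RiemannianGeometry.dirDeriv_mul (h.mdiffAt hf hy) (h.mdiffAt hf' hy)

theorem ext {v w : TangentSpace I y} (hy : y ∈ U) (h1 : g.inner y v (e₁ y) = g.inner y w (e₁ y))
    (h2 : g.inner y v (e₂ y) = g.inner y w (e₂ y)) : v = w := by
  rw [h.decomp y hy v, h.decomp y hy w, h1, h2]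

theorem apply_eq {F : Type*} [AddCommGroup F] [Module ℝ F] [TopologicalSpace F] (hy : y ∈ U)
    (α : TangentSpace I y →L[ℝ] F) (v : TangentSpace I y) :
    α v = g.inner y v (e₁ y) • α (e₁ y) + g.inner y v (e₂ y) • α (e₂ y) := by
  conv_lhs => rw [h.decomp y hy v]
  rw [map_add, map_smul, map_smul]

theorem dirDeriv_eq (hy : y ∈ U) : dirDeriv X f y =
    g.inner y (X y) (e₁ y) * dirDeriv e₁ f y + g.inner y (X y) (e₂ y) * dirDeriv e₂ f y :=
  h.apply_eq hy (mvfderiv I f y) (X y)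

theorem contMDiffOn_of_inner (h1 : CMDiff[U] ∞ (fun y ↦ g.inner y (X y) (e₁ y)))
    (h2 : CMDiff[U] ∞ (fun y ↦ g.inner y (X y) (e₂ y))) : CMDiff[U] ∞ (T% X) := by
  refine ((h1.smul_section h.smooth₁).add_section (h2.smul_section h.smooth₂)).congr fun y hy ↦ ?_
  congr 1
  exact h.decomp y hy (X y)

theorem contMDiffOn_dirDeriv (hX : CMDiff[U] ∞ (T% X)) (hf : CMDiff[U] ∞ f) :
    CMDiff[U] ∞ (dirDeriv X f) :=
  contMDiffOn_dirDeriv_of_unit g h.isOpen h.smooth₁ h.inner₁₁ hX hf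

theorem dirDeriv_mlieBracket (hX : CMDiff[U] ∞ (T% X)) (hY : CMDiff[U] ∞ (T% Y))
    (hf : CMDiff[U] ∞ f) (hy : y ∈ U) :
    dirDeriv (VectorField.mlieBracket I X Y) f y =
      dirDeriv X (dirDeriv Y f) y - dirDeriv Y (dirDeriv X f) y :=
  dirDeriv_mlieBracket_of_unit g h.isOpen h.smooth₁ h.inner₁₁ hX hY hf hy

theorem mvfderiv_inner (hX : CMDiff[U] ∞ (T% X)) (hY : CMDiff[U] ∞ (T% Y)) (hy : y ∈ U)
    (v : TangentSpace I y) : mvfderiv I (fun y ↦ g.inner y (X y) (Y y)) y v =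
      g.inner y (leviCivita g X y v) (Y y) + g.inner y (X y) (leviCivita g Y y v) := by
  have := leviCivita_metric g (mdifferentiableAt_extend I E v) (h.mdiffAt_field hX hy)
    (h.mdiffAt_field hY hy)
  simpa using this

/-- Differentiating `g(e₁, e₁) = 1` shows that `D_v e₁` has no `e₁` component. -/
theorem leviCivita_frame₁ (hy : y ∈ U) (v : TangentSpace I y) :
    leviCivita g e₁ y v = connForm g e₁ e₂ y v • e₂ y := by
  refine h.ext hy ?_ ?_
  · have h1 := h.mvfderiv_inner h.smooth₁ h.smooth₁ hy v
    rw [mvfderiv_congr (f' := fun _ ↦ 1)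
      (Filter.eventuallyEq_of_mem (h.isOpen.mem_nhds hy) h.inner₁₁), mvfderiv_const,
      g.symm y (e₁ y)] at h1
    simp [h.inner₂₁ y hy] at h1 ⊢
    linarith
  · simp [h.inner₂₂ y hy, connForm]

theorem leviCivita_frame₂ (hy : y ∈ U) (v : TangentSpace I y) :
    leviCivita g e₂ y v = - connForm g e₁ e₂ y v • e₁ y := by
  refine h.ext hy ?_ ?_
  · have h1 := h.mvfderiv_inner h.smooth₁ h.smooth₂ hy v
    rw [mvfderiv_congr (f' := fun _ ↦ 0)
      (Filter.eventuallyEq_of_mem (h.isOpen.mem_nhds hy) h.inner₁₂), mvfderiv_const,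
      g.symm y (e₁ y)] at h1
    simp [h.inner₁₁ y hy, connForm] at h1 ⊢
    linarith
  · have h1 := h.mvfderiv_inner h.smooth₂ h.smooth₂ hy v
    rw [mvfderiv_congr (f' := fun _ ↦ 1)
      (Filter.eventuallyEq_of_mem (h.isOpen.mem_nhds hy) h.inner₂₂), mvfderiv_const,
      g.symm y (e₂ y)] at h1
    simp [h.inner₁₂ y hy] at h1 ⊢
    linarith

theorem connForm_eq (hy : y ∈ U) (v : TangentSpace I y) : connForm g e₁ e₂ y v =
    g.inner y v (e₁ y) * conn₁ g e₁ e₂ y + g.inner y v (e₂ y) * conn₂ g e₁ e₂ y := by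
  simp only [connForm, conn₁, conn₂]
  rw [h.apply_eq hy (leviCivita g e₁ y) v]
  simp

theorem inner_leviCivita₁ (hZ : CMDiff[U] ∞ (T% Z)) (hy : y ∈ U) (v : TangentSpace I y) :
    g.inner y (leviCivita g Z y v) (e₁ y) =
      mvfderiv I (fun y ↦ g.inner y (Z y) (e₁ y)) y v
        - connForm g e₁ e₂ y v * g.inner y (Z y) (e₂ y) := by
  rw [h.mvfderiv_inner hZ h.smooth₁ hy, h.leviCivita_frame₁ hy]
  simp

theorem inner_leviCivita₂ (hZ : CMDiff[U] ∞ (T% Z)) (hy : y ∈ U) (v : TangentSpace I y) :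
    g.inner y (leviCivita g Z y v) (e₂ y) =
      mvfderiv I (fun y ↦ g.inner y (Z y) (e₂ y)) y v
        + connForm g e₁ e₂ y v * g.inner y (Z y) (e₁ y) := by
  rw [h.mvfderiv_inner hZ h.smooth₂ hy, h.leviCivita_frame₂ hy]
  simp

theorem mlieBracket_eq (hX : CMDiff[U] ∞ (T% X)) (hY : CMDiff[U] ∞ (T% Y)) (hy : y ∈ U) :
    VectorField.mlieBracket I X Y y = leviCivita g Y y (X y) - leviCivita g X y (Y y) :=
  (((leviCivita g).torsion_eq_zero_iff.1 (leviCivita_torsion g)) (h.mdiffAt_field hX hy)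
    (h.mdiffAt_field hY hy)).symm

theorem mlieBracket_frame (hy : y ∈ U) : VectorField.mlieBracket I e₁ e₂ y =
    - conn₁ g e₁ e₂ y • e₁ y - conn₂ g e₁ e₂ y • e₂ y := by
  rw [h.mlieBracket_eq h.smooth₁ h.smooth₂ hy, h.leviCivita_frame₁ hy, h.leviCivita_frame₂ hy]
  rfl

/-- The Levi-Civita connection is defined pointwise by the Koszul formula. Smoothness of its
coefficients comes from the bracket: by vanishing torsion they are, up to sign, the components of
`[e₁, e₂]`. -/
theorem contMDiffOn_conn₁ : CMDiff[U] ∞ (conn₁ g e₁ e₂) := by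
  refine (contMDiffOn_inner g (contMDiffOn_mlieBracket h.isOpen h.smooth₁ h.smooth₂)
    h.smooth₁).neg.congr fun y hy ↦ ?_
  simp [h.mlieBracket_frame hy, h.inner₁₁ y hy, h.inner₂₁ y hy]

theorem contMDiffOn_conn₂ : CMDiff[U] ∞ (conn₂ g e₁ e₂) := by
  refine (contMDiffOn_inner g (contMDiffOn_mlieBracket h.isOpen h.smooth₁ h.smooth₂)
    h.smooth₂).neg.congr fun y hy ↦ ?_
  simp [h.mlieBracket_frame hy, h.inner₁₂ y hy, h.inner₂₂ y hy]

theorem contMDiffOn_frameCurvature : CMDiff[U] ∞ (frameCurvature g e₁ e₂) := by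
  have h1 := h.contMDiffOn_conn₁
  have h2 := h.contMDiffOn_conn₂
  exact (((h.contMDiffOn_dirDeriv h.smooth₂ h1).sub (h.contMDiffOn_dirDeriv h.smooth₁ h2)).sub
    (h1.pow 2)).sub (h2.pow 2)

theorem dirDeriv_dirDeriv (hf : CMDiff[U] ∞ f) (hy : y ∈ U) :
    dirDeriv e₁ (dirDeriv e₂ f) y - dirDeriv e₂ (dirDeriv e₁ f) y =
      - conn₁ g e₁ e₂ y * dirDeriv e₁ f y - conn₂ g e₁ e₂ y * dirDeriv e₂ f y := by
  rw [← h.dirDeriv_mlieBracket h.smooth₁ h.smooth₂ hf hy, dirDeriv, h.mlieBracket_frame hy]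
  simp [dirDeriv]

theorem contMDiffOn_connForm (hX : CMDiff[U] ∞ (T% X)) :
    CMDiff[U] ∞ (fun y ↦ connForm g e₁ e₂ y (X y)) :=
  (((contMDiffOn_inner g hX h.smooth₁).mul h.contMDiffOn_conn₁).add
    ((contMDiffOn_inner g hX h.smooth₂).mul h.contMDiffOn_conn₂)).congr
      fun _ hy ↦ h.connForm_eq hy _

theorem contMDiffOn_leviCivita (hZ : CMDiff[U] ∞ (T% Z)) (hX : CMDiff[U] ∞ (T% X)) :
    CMDiff[U] ∞ (T% (fun y ↦ leviCivita g Z y (X y))) := by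
  have hω := h.contMDiffOn_connForm hX
  have hZ1 := contMDiffOn_inner g hZ h.smooth₁
  have hZ2 := contMDiffOn_inner g hZ h.smooth₂
  refine h.contMDiffOn_of_inner ?_ ?_
  · exact ((h.contMDiffOn_dirDeriv hX hZ1).sub (hω.mul hZ2)).congr
      fun y hy ↦ h.inner_leviCivita₁ hZ hy _
  · exact ((h.contMDiffOn_dirDeriv hX hZ2).add (hω.mul hZ1)).congr
      fun y hy ↦ h.inner_leviCivita₂ hZ hy _

/-- The exterior derivative of the connection form is `-c` times the area form. -/
theorem connForm_exterior (hX : CMDiff[U] ∞ (T% X)) (hY : CMDiff[U] ∞ (T% Y)) (hy : y ∈ U) :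
    dirDeriv X (fun y ↦ connForm g e₁ e₂ y (Y y)) y
      - dirDeriv Y (fun y ↦ connForm g e₁ e₂ y (X y)) y
      - connForm g e₁ e₂ y (VectorField.mlieBracket I X Y y) =
    - frameCurvature g e₁ e₂ y * (g.inner y (X y) (e₁ y) * g.inner y (Y y) (e₂ y)
      - g.inner y (X y) (e₂ y) * g.inner y (Y y) (e₁ y)) := by
  have h1 := h.contMDiffOn_conn₁
  have h2 := h.contMDiffOn_conn₂
  have expand : ∀ {V W : Π x : M, TangentSpace I x}, CMDiff[U] ∞ (T% W) →
      dirDeriv V (fun y ↦ connForm g e₁ e₂ y (W y)) y =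
      (g.inner y (W y) (e₁ y) * dirDeriv V (conn₁ g e₁ e₂) y
        + conn₁ g e₁ e₂ y * dirDeriv V (fun y ↦ g.inner y (W y) (e₁ y)) y)
      + (g.inner y (W y) (e₂ y) * dirDeriv V (conn₂ g e₁ e₂) y
        + conn₂ g e₁ e₂ y * dirDeriv V (fun y ↦ g.inner y (W y) (e₂ y)) y) := by
    intro V W hW
    have hW1 := contMDiffOn_inner g hW h.smooth₁
    have hW2 := contMDiffOn_inner g hW h.smooth₂
    rw [dirDeriv_congr h.isOpen (fun z hz ↦ h.connForm_eq hz (W z)) hy,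
      h.dirDeriv_add (contMDiffOn_mul hW1 h1) (contMDiffOn_mul hW2 h2) hy,
      h.dirDeriv_mul hW1 h1 hy, h.dirDeriv_mul hW2 h2 hy]
  rw [expand hY, expand hX, h.connForm_eq hy (VectorField.mlieBracket I X Y y),
    h.mlieBracket_eq hX hY hy]
  simp only [map_sub, sub_apply]
  rw [h.inner_leviCivita₁ hX hy, h.inner_leviCivita₁ hY hy, h.inner_leviCivita₂ hX hy,
    h.inner_leviCivita₂ hY hy, h.connForm_eq hy (X y), h.connForm_eq hy (Y y),
    h.dirDeriv_eq (X := X) (f := conn₁ g e₁ e₂) hy, h.dirDeriv_eq (X := X) (f := conn₂ g e₁ e₂) hy,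
    h.dirDeriv_eq (X := Y) (f := conn₁ g e₁ e₂) hy, h.dirDeriv_eq (X := Y) (f := conn₂ g e₁ e₂) hy]
  simp only [frameCurvature, dirDeriv]
  ring

/-- In components `D` acts as differentiation plus a rotation by `ω`. Rotations of the plane
commute, so the terms quadratic in `ω` are symmetric in `X, Y` and drop out. The second derivatives
combine to the bracket term, and only `dω` is left. -/
theorem curvatureField_leviCivita (hX : CMDiff[U] ∞ (T% X)) (hY : CMDiff[U] ∞ (T% Y))
    (hZ : CMDiff[U] ∞ (T% Z)) (hy : y ∈ U) :
    curvatureField (fun σ y v ↦ leviCivita g σ y v) X Y Z y =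
      (frameCurvature g e₁ e₂ y * (g.inner y (X y) (e₁ y) * g.inner y (Y y) (e₂ y)
        - g.inner y (X y) (e₂ y) * g.inner y (Y y) (e₁ y))) •
      (g.inner y (Z y) (e₂ y) • e₁ y - g.inner y (Z y) (e₁ y) • e₂ y) := by
  have hZ1 := contMDiffOn_inner g hZ h.smooth₁
  have hZ2 := contMDiffOn_inner g hZ h.smooth₂
  have key := h.connForm_exterior hX hY hy
  have b1 := h.dirDeriv_mlieBracket hX hY hZ1 hy
  have b2 := h.dirDeriv_mlieBracket hX hY hZ2 hy
  have second₁ : ∀ {V W : Π x : M, TangentSpace I x}, CMDiff[U] ∞ (T% V) → CMDiff[U] ∞ (T% W) →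
      g.inner y (leviCivita g (fun y ↦ leviCivita g Z y (W y)) y (V y)) (e₁ y) =
      dirDeriv V (dirDeriv W (fun y ↦ g.inner y (Z y) (e₁ y))) y
      - (connForm g e₁ e₂ y (W y) * dirDeriv V (fun y ↦ g.inner y (Z y) (e₂ y)) y
        + g.inner y (Z y) (e₂ y) * dirDeriv V (fun y ↦ connForm g e₁ e₂ y (W y)) y)
      - connForm g e₁ e₂ y (V y) * (dirDeriv W (fun y ↦ g.inner y (Z y) (e₂ y)) y
        + connForm g e₁ e₂ y (W y) * g.inner y (Z y) (e₁ y)) := by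
    intro V W hV hW
    have hω := h.contMDiffOn_connForm hW
    rw [h.inner_leviCivita₁ (h.contMDiffOn_leviCivita hZ hW) hy, h.inner_leviCivita₂ hZ hy]
    change dirDeriv V _ y - _ = _
    rw [dirDeriv_congr h.isOpen (fun z hz ↦ h.inner_leviCivita₁ hZ hz (W z)) hy, ← h.dirDeriv_mul hω hZ2 hy]
    rw [← h.dirDeriv_sub (h.contMDiffOn_dirDeriv hW hZ1) (contMDiffOn_mul hω hZ2) hy]
    rfl
  have second₂ : ∀ {V W : Π x : M, TangentSpace I x}, CMDiff[U] ∞ (T% V) → CMDiff[U] ∞ (T% W) →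
      g.inner y (leviCivita g (fun y ↦ leviCivita g Z y (W y)) y (V y)) (e₂ y) =
      dirDeriv V (dirDeriv W (fun y ↦ g.inner y (Z y) (e₂ y))) y
      + (connForm g e₁ e₂ y (W y) * dirDeriv V (fun y ↦ g.inner y (Z y) (e₁ y)) y
        + g.inner y (Z y) (e₁ y) * dirDeriv V (fun y ↦ connForm g e₁ e₂ y (W y)) y)
      + connForm g e₁ e₂ y (V y) * (dirDeriv W (fun y ↦ g.inner y (Z y) (e₁ y)) y
        - connForm g e₁ e₂ y (W y) * g.inner y (Z y) (e₂ y)) := by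
    intro V W hV hW
    have hω := h.contMDiffOn_connForm hW
    rw [h.inner_leviCivita₂ (h.contMDiffOn_leviCivita hZ hW) hy, h.inner_leviCivita₁ hZ hy]
    change dirDeriv V _ y + _ = _
    rw [dirDeriv_congr h.isOpen (fun z hz ↦ h.inner_leviCivita₂ hZ hz (W z)) hy, ← h.dirDeriv_mul hω hZ1 hy]
    rw [← h.dirDeriv_add (h.contMDiffOn_dirDeriv hW hZ2) (contMDiffOn_mul hω hZ1) hy]
    rfl
  refine h.ext hy ?_ ?_
  · simp only [curvatureField, map_sub, sub_apply]
    rw [second₁ hX hY, second₁ hY hX, h.inner_leviCivita₁ hZ hy]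
    simp only [map_smul, map_sub, smul_apply, sub_apply, h.inner₁₁ y hy, h.inner₂₁ y hy,
      smul_eq_mul]
    change _ - (dirDeriv _ _ _ - _) = _
    rw [b1]
    linear_combination (-g.inner y (Z y) (e₂ y)) * key
  · simp only [curvatureField, map_sub, sub_apply]
    rw [second₂ hX hY, second₂ hY hX, h.inner_leviCivita₂ hZ hy]
    simp only [map_smul, map_sub, smul_apply, sub_apply, h.inner₁₂ y hy, h.inner₂₂ y hy,
      smul_eq_mul]
    change _ - (dirDeriv _ _ _ + _) = _
    rw [b2]
    linear_combination (g.inner y (Z y) (e₁ y)) * key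

/-- Both sides are trilinear, so it is enough to compare them on the basis by which `riemann` is
defined. -/
theorem riemann_apply (hy : y ∈ U) (u v w : TangentSpace I y) :
    riemann g y u v w =
      (frameCurvature g e₁ e₂ y * (g.inner y u (e₁ y) * g.inner y v (e₂ y)
        - g.inner y u (e₂ y) * g.inner y v (e₁ y))) •
      (g.inner y w (e₂ y) • e₁ y - g.inner y w (e₁ y) • e₂ y) := by
  set b := Module.finBasis ℝ (TangentSpace I y) with hb
  have hcurv : ∀ i j k, curvatureField (fun σ y v ↦ leviCivita g σ y v)
      (extend E (b i)) (extend E (b j)) (extend E (b k)) y =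
      (frameCurvature g e₁ e₂ y * (g.inner y (b i) (e₁ y) * g.inner y (b j) (e₂ y)
        - g.inner y (b i) (e₂ y) * g.inner y (b j) (e₁ y))) •
      (g.inner y (b k) (e₂ y) • e₁ y - g.inner y (b k) (e₁ y) • e₂ y) := by
    intro i j k
    obtain ⟨s, hs, hsi⟩ := exists_contMDiffOn_extend (k := ∞) I E (b i)
    obtain ⟨s', hs', hsj⟩ := exists_contMDiffOn_extend (k := ∞) I E (b j)
    obtain ⟨s'', hs'', hsk⟩ := exists_contMDiffOn_extend (k := ∞) I E (b k)
    -- The extensions of the three basis vectors are smooth only near `y`, so the frame is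
    -- restricted to an open set where all of them are.
    obtain ⟨W, hW, hWo, hyW⟩ := mem_nhds_iff.1
      (Filter.inter_mem (Filter.inter_mem hs hs') (Filter.inter_mem hs'' (h.isOpen.mem_nhds hy)))
    have := (h.mono hWo (fun z hz ↦ (hW hz).2.2)).curvatureField_leviCivita
      (hsi.mono fun z hz ↦ (hW hz).1.1) (hsj.mono fun z hz ↦ (hW hz).1.2)
      (hsk.mono fun z hz ↦ (hW hz).2.1) hyW
    simpa using this
  have lin : ∀ φ : TangentSpace I y → TangentSpace I y, IsLinearMap ℝ φ → ∀ z,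
      ∑ k, b.coord k z • φ (b k) = φ z := by
    intro φ hφ z
    have := map_sum (IsLinearMap.mk' φ hφ) (fun k ↦ b.repr z k • b k) Finset.univ
    rw [b.sum_repr] at this
    simpa using this.symm
  have lin₁ := lin (fun u ↦ (frameCurvature g e₁ e₂ y * (g.inner y u (e₁ y) * g.inner y v (e₂ y)
        - g.inner y u (e₂ y) * g.inner y v (e₁ y))) •
      (g.inner y w (e₂ y) • e₁ y - g.inner y w (e₁ y) • e₂ y))
      ⟨fun _ _ ↦ by simp; module, fun _ _ ↦ by simp; module⟩ u
  have lin₂ := fun i ↦ lin (fun v ↦ (frameCurvature g e₁ e₂ y *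
        (g.inner y (b i) (e₁ y) * g.inner y v (e₂ y)
        - g.inner y (b i) (e₂ y) * g.inner y v (e₁ y))) •
      (g.inner y w (e₂ y) • e₁ y - g.inner y w (e₁ y) • e₂ y))
      ⟨fun _ _ ↦ by simp; module, fun _ _ ↦ by simp; module⟩ v
  have lin₃ := fun i j ↦ lin (fun w ↦ (frameCurvature g e₁ e₂ y *
        (g.inner y (b i) (e₁ y) * g.inner y (b j) (e₂ y)
        - g.inner y (b i) (e₂ y) * g.inner y (b j) (e₁ y))) •
      (g.inner y w (e₂ y) • e₁ y - g.inner y w (e₁ y) • e₂ y))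
      ⟨fun _ _ ↦ by simp; module, fun _ _ ↦ by simp; module⟩ w
  simp only [riemann, ← hb, hcurv, sum_apply, ContinuousLinearMap.smulRight_apply,
    smul_apply, LinearMap.coe_toContinuousLinearMap', ← Finset.smul_sum]
  rw [← lin₁]
  refine Finset.sum_congr rfl fun i _ ↦ ?_
  rw [← lin₂]
  congr 1
  refine Finset.sum_congr rfl fun j _ ↦ ?_
  rw [← lin₃]

end IsOrthonormalFrameOn

end

/-! ### Smoothness of covector fields and bilinear forms -/

section
variable {E : Type*} [NormedAddCommGroup E] [NormedSpace ℝ E] [FiniteDimensional ℝ E]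
  {H : Type*} [TopologicalSpace H] {I : ModelWithCorners ℝ E H}
  {M : Type*} [TopologicalSpace M] [ChartedSpace H M] [IsManifold I ∞ M]
  {g : ContMDiffRiemannianMetric I ∞ E (TangentSpace I : M → Type _)}
  {e₁ e₂ X Y Z : Π x : M, TangentSpace I x} {U : Set M} {x y : M} {f f' : M → ℝ}
  {K K' : Π x : M, TangentSpace I x →L[ℝ] ℝ}
  {L L' : Π x : M, TangentSpace I x →L[ℝ] TangentSpace I x →L[ℝ] ℝ}

variable (K U) in
/-- Smoothness on `U` of a covector field. -/
abbrev SmoothCovectorOn : Prop :=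
  ContMDiffOn I (I.prod 𝓘(ℝ, E →L[ℝ] ℝ)) ∞ (fun y ↦ TotalSpace.mk' (E →L[ℝ] ℝ) y (K y)) U

variable (L U) in
/-- Smoothness on `U` of a field of bilinear forms. -/
abbrev SmoothBilinOn : Prop :=
  ContMDiffOn I (I.prod 𝓘(ℝ, E →L[ℝ] E →L[ℝ] ℝ)) ∞
    (fun y ↦ TotalSpace.mk' (E →L[ℝ] E →L[ℝ] ℝ) y (L y)) U

theorem SmoothCovectorOn.add (hK : SmoothCovectorOn U K) (hK' : SmoothCovectorOn U K') :
    SmoothCovectorOn U (fun y ↦ K y + K' y) :=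
  ContMDiffOn.add_section (F := E →L[ℝ] ℝ) (V := fun y ↦ TangentSpace I y →L[ℝ] ℝ) hK hK'

theorem SmoothCovectorOn.smul (hf : CMDiff[U] ∞ f) (hK : SmoothCovectorOn U K) :
    SmoothCovectorOn U (fun y ↦ f y • K y) :=
  ContMDiffOn.smul_section (F := E →L[ℝ] ℝ) (V := fun y ↦ TangentSpace I y →L[ℝ] ℝ) hf hK

set_option synthInstance.maxHeartbeats 200000 in
theorem SmoothBilinOn.add (hL : SmoothBilinOn U L) (hL' : SmoothBilinOn U L') :
    SmoothBilinOn U (fun y ↦ L y + L' y) :=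
  ContMDiffOn.add_section (F := E →L[ℝ] E →L[ℝ] ℝ)
    (V := fun y ↦ TangentSpace I y →L[ℝ] TangentSpace I y →L[ℝ] ℝ) hL hL'

theorem contMDiffWithinAt_smulRight {F : Type*} [NormedAddCommGroup F] [NormedSpace ℝ F]
    {a : M → E →L[ℝ] ℝ} {b : M → F} (ha : ContMDiffWithinAt I 𝓘(ℝ, E →L[ℝ] ℝ) ∞ a U x)
    (hb : ContMDiffWithinAt I 𝓘(ℝ, F) ∞ b U x) :
    ContMDiffWithinAt I 𝓘(ℝ, E →L[ℝ] F) ∞ (fun y ↦ (a y).smulRight (b y)) U x :=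
  (isBoundedBilinearMap_smulRight.contDiff (n := ∞)).contMDiff.contMDiffAt.comp_contMDiffWithinAt x
    (ha.prodMk_space hb)

/-- In the trivializations at `x` the coordinate expression of a tensor product is the tensor
product of the coordinate expressions, and this is a bounded bilinear operation. The work is to
identify the expressions on the base set. -/
theorem SmoothCovectorOn.smulRight (hK : SmoothCovectorOn U K) (hK' : SmoothCovectorOn U K') :
    SmoothBilinOn U (fun y ↦ (K y).smulRight (K' y)) := by
  intro x hx
  have h1 := hK x hx
  have h2 := hK' x hx
  rw [contMDiffWithinAt_hom_bundle] at h1 h2 ⊢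
  refine ⟨contMDiffWithinAt_id, ?_⟩
  refine (contMDiffWithinAt_smulRight h1.2 h2.2).congr_of_eventuallyEq_of_mem ?_ hx
  filter_upwards [nhdsWithin_le_nhds ((trivializationAt E (TangentSpace I : M → Type _)
    x).open_baseSet.mem_nhds (FiberBundle.mem_baseSet_trivializationAt' x))] with y hy
  have hy' : y ∈ (trivializationAt (E →L[ℝ] ℝ)
      (fun y : M ↦ TangentSpace I y →L[ℝ] Bundle.Trivial M ℝ y) x).baseSet := by
    simpa using hy
  have hβ := (trivializationAt (E →L[ℝ] ℝ) (fun y : M ↦ TangentSpace I y →L[ℝ]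
    Bundle.Trivial M ℝ y) x).continuousLinearMapAt_apply_of_mem (R := ℝ) hy' (K' y)
  rw [hom_trivializationAt_apply] at hβ
  ext u v
  have hα : ∀ α : TangentSpace I y →L[ℝ] ℝ,
      ContinuousLinearMap.inCoordinates E (TangentSpace I) ℝ (fun _ ↦ ℝ) x y x y α u =
      α ((trivializationAt E (TangentSpace I : M → Type _) x).symmL ℝ y u) := by
    intro α
    simp [ContinuousLinearMap.inCoordinates]
  change ((trivializationAt (E →L[ℝ] ℝ) (fun y : M ↦ TangentSpace I y →L[ℝ]
    Bundle.Trivial M ℝ y) x).continuousLinearMapAt ℝ y (((K y).smulRight (K' y))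
      ((trivializationAt E (TangentSpace I : M → Type _) x).symmL ℝ y u))) v = _
  rw [ContinuousLinearMap.smulRight_apply, map_smul, hβ, ContinuousLinearMap.smulRight_apply, hα]

end

/-! ### Sections of `W` and the connection `∇` in a frame -/

section
variable {E : Type*} [NormedAddCommGroup E] [NormedSpace ℝ E] [FiniteDimensional ℝ E]
  {H : Type*} [TopologicalSpace H] {I : ModelWithCorners ℝ E H}
  {M : Type*} [TopologicalSpace M] [ChartedSpace H M] [IsManifold I ∞ M]
  {g : ContMDiffRiemannianMetric I ∞ E (TangentSpace I : M → Type _)}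
  {e₁ e₂ X Y Z : Π x : M, TangentSpace I x} {U : Set M} {x y : M} {f f' : M → ℝ}
  {K K' : Π x : M, TangentSpace I x →L[ℝ] ℝ}
  {L L' : Π x : M, TangentSpace I x →L[ℝ] TangentSpace I x →L[ℝ] ℝ}
  {s : Π x : M, WFiber I x}

theorem apply_swap_of_inW {w : WFiber I x} (hw : InW x w) (u v : TangentSpace I x) :
    w.2 u v = - w.2 v u := by
  have h1 := hw (u + v)
  simp [hw u, hw v] at h1
  linarith

namespace IsOrthonormalFrameOn

variable (h : IsOrthonormalFrameOn g e₁ e₂ U)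
include h

theorem covector_ext {α β : TangentSpace I y →L[ℝ] ℝ} (hy : y ∈ U) (h1 : α (e₁ y) = β (e₁ y))
    (h2 : α (e₂ y) = β (e₂ y)) : α = β := by
  ext v
  rw [h.apply_eq hy α, h.apply_eq hy β, h1, h2]

/-- On a surface `W` has rank three: `L` alternating is determined by `l = L(e₁, e₂)`. -/
theorem wFiber_ext {w w' : WFiber I y} (hy : y ∈ U) (hw : InW y w) (hw' : InW y w')
    (h1 : w.1 (e₁ y) = w'.1 (e₁ y)) (h2 : w.1 (e₂ y) = w'.1 (e₂ y))
    (h3 : w.2 (e₁ y) (e₂ y) = w'.2 (e₁ y) (e₂ y)) : w = w' := by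
  refine Prod.ext (h.covector_ext hy h1 h2) ?_
  have h4 : w.2 (e₂ y) (e₁ y) = w'.2 (e₂ y) (e₁ y) := by
    rw [apply_swap_of_inW hw, h3, apply_swap_of_inW hw' (e₂ y)]
  ext u v
  rw [h.apply_eq hy w.2 u, h.apply_eq hy w'.2 u]
  simp only [add_apply, smul_apply]
  rw [h.apply_eq hy (w.2 (e₁ y)) v, h.apply_eq hy (w'.2 (e₁ y)) v,
    h.apply_eq hy (w.2 (e₂ y)) v, h.apply_eq hy (w'.2 (e₂ y)) v, hw, hw, hw', hw', h3, h4]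

theorem smooth_flat (hX : CMDiff[U] ∞ (T% X)) : SmoothCovectorOn U (fun y ↦ g.inner y (X y)) :=
  contMDiffOn_bilin_apply g.contMDiff.contMDiffOn hX

theorem smoothCovectorOn (h1 : CMDiff[U] ∞ (fun y ↦ K y (e₁ y)))
    (h2 : CMDiff[U] ∞ (fun y ↦ K y (e₂ y))) : SmoothCovectorOn U K := by
  refine ((h.smooth_flat h.smooth₁).smul h1 |>.add ((h.smooth_flat h.smooth₂).smul h2)).congr
    fun y hy ↦ ?_
  congr 1
  refine h.covector_ext hy ?_ ?_
  · simp [h.inner₁₁ y hy, h.inner₂₁ y hy]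
  · simp [h.inner₁₂ y hy, h.inner₂₂ y hy]

/-- The form `L` is rebuilt from its one component as `l (e₁♭ ⊗ e₂♭ - e₂♭ ⊗ e₁♭)`. -/
theorem smoothWSectionOn (hs : ∀ y ∈ U, InW y (s y)) (h1 : CMDiff[U] ∞ (fun y ↦ (s y).1 (e₁ y)))
    (h2 : CMDiff[U] ∞ (fun y ↦ (s y).1 (e₂ y)))
    (h3 : CMDiff[U] ∞ (fun y ↦ (s y).2 (e₁ y) (e₂ y))) : SmoothWSectionOn s U := by
  refine ⟨h.smoothCovectorOn h1 h2, ?_⟩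
  have s1 := h.smooth_flat h.smooth₁
  have s2 := h.smooth_flat h.smooth₂
  refine (((s1.smul h3).smulRight s2).add ((s2.smul h3.neg).smulRight s1)).congr fun y hy ↦ ?_
  congr 1
  have := h.wFiber_ext (w := s y) (w' := ((s y).1, ((s y).2 (e₁ y) (e₂ y) •
    g.inner y (e₁ y)).smulRight (g.inner y (e₂ y)) + ((-(s y).2 (e₁ y) (e₂ y)) •
    g.inner y (e₂ y)).smulRight (g.inner y (e₁ y)))) hy (hs y hy) (fun v ↦ by simp; ring) rfl rfl
    (by simp [h.inner₁₁ y hy, h.inner₂₂ y hy, h.inner₂₁ y hy])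
  exact congrArg Prod.snd this

theorem covectorDeriv₁ (hK : SmoothCovectorOn U K) (hy : y ∈ U) (v : TangentSpace I y) :
    covectorDeriv (leviCivita g) K y v (e₁ y) =
      mvfderiv I (fun y ↦ K y (e₁ y)) y v - connForm g e₁ e₂ y v * K y (e₂ y) := by
  rw [covectorDeriv_apply _ (mdiffAt_of_contMDiffOn h.isOpen hK hy) (h.mdiffAt_field h.smooth₁ hy),
    h.leviCivita_frame₁ hy]
  simp

theorem covectorDeriv₂ (hK : SmoothCovectorOn U K) (hy : y ∈ U) (v : TangentSpace I y) :
    covectorDeriv (leviCivita g) K y v (e₂ y) =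
      mvfderiv I (fun y ↦ K y (e₂ y)) y v + connForm g e₁ e₂ y v * K y (e₁ y) := by
  rw [covectorDeriv_apply _ (mdiffAt_of_contMDiffOn h.isOpen hK hy) (h.mdiffAt_field h.smooth₂ hy),
    h.leviCivita_frame₂ hy]
  simp

theorem bilinDeriv_alternating (hs : SmoothWSectionOn s U) (hW : ∀ y ∈ U, InW y (s y))
    (hy : y ∈ U) (v u : TangentSpace I y) :
    bilinDeriv (leviCivita g) (fun y ↦ (s y).2) y v u u = 0 := by
  have hd := bilinDeriv_apply (leviCivita g) (mdiffAt_of_contMDiffOn h.isOpen hs.2 hy)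
    (mdifferentiableAt_extend I E u) (mdifferentiableAt_extend I E u) v
  rw [mvfderiv_congr (f' := fun _ ↦ 0) (Filter.eventuallyEq_of_mem (h.isOpen.mem_nhds hy)
    fun z hz ↦ hW z hz _), mvfderiv_const, apply_swap_of_inW (hW y hy)] at hd
  simpa using hd

/-- No connection term appears: `D_v e₁` is a multiple of `e₂` and `D_v e₂` of `e₁`, and `L` is
alternating. In other words, the area form is parallel. -/
theorem bilinDeriv₁₂ (hs : SmoothWSectionOn s U) (hW : ∀ y ∈ U, InW y (s y))
    (hy : y ∈ U) (v : TangentSpace I y) :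
    bilinDeriv (leviCivita g) (fun y ↦ (s y).2) y v (e₁ y) (e₂ y) =
      mvfderiv I (fun y ↦ (s y).2 (e₁ y) (e₂ y)) y v := by
  rw [bilinDeriv_apply _ (mdiffAt_of_contMDiffOn h.isOpen hs.2 hy) (h.mdiffAt_field h.smooth₁ hy)
    (h.mdiffAt_field h.smooth₂ hy), h.leviCivita_frame₁ hy, h.leviCivita_frame₂ hy]
  simp [hW y hy (e₁ y), hW y hy (e₂ y)]

theorem curvatureTerm_apply (hy : y ∈ U) (u v w : TangentSpace I y) :
    curvatureTerm g K y w u v = - (frameCurvature g e₁ e₂ y *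
      (g.inner y u (e₁ y) * g.inner y v (e₂ y) - g.inner y u (e₂ y) * g.inner y v (e₁ y)) *
      (g.inner y w (e₂ y) * K y (e₁ y) - g.inner y w (e₁ y) * K y (e₂ y))) := by
  change - K y (riemann g y u v w) = _
  rw [h.riemann_apply hy]
  simp

theorem inW_wConnection (hs : SmoothWSectionOn s U) (hW : ∀ y ∈ U, InW y (s y))
    (hy : y ∈ U) (v : TangentSpace I y) : InW y (wConnection g s y v) := by
  intro u
  simp only [wConnection, sub_apply]
  rw [h.bilinDeriv_alternating hs hW hy, h.curvatureTerm_apply hy]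
  ring

theorem wConnection₁ (hs : SmoothWSectionOn s U) (hW : ∀ y ∈ U, InW y (s y))
    (hy : y ∈ U) (v : TangentSpace I y) : (wConnection g s y v).1 (e₁ y) =
      mvfderiv I (fun y ↦ (s y).1 (e₁ y)) y v - connForm g e₁ e₂ y v * (s y).1 (e₂ y)
      - g.inner y v (e₂ y) * (s y).2 (e₁ y) (e₂ y) := by
  simp only [wConnection, sub_apply, swap_apply]
  rw [h.covectorDeriv₁ hs.1 hy, h.apply_eq hy ((s y).2 (e₁ y)) v, hW y hy]
  simp

theorem wConnection₂ (hs : SmoothWSectionOn s U) (hW : ∀ y ∈ U, InW y (s y))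
    (hy : y ∈ U) (v : TangentSpace I y) : (wConnection g s y v).1 (e₂ y) =
      mvfderiv I (fun y ↦ (s y).1 (e₂ y)) y v + connForm g e₁ e₂ y v * (s y).1 (e₁ y)
      + g.inner y v (e₁ y) * (s y).2 (e₁ y) (e₂ y) := by
  simp only [wConnection, sub_apply, swap_apply]
  rw [h.covectorDeriv₂ hs.1 hy, h.apply_eq hy ((s y).2 (e₂ y)) v, hW y hy,
    apply_swap_of_inW (hW y hy) (e₂ y)]
  simp

theorem wConnection₃ (hs : SmoothWSectionOn s U) (hW : ∀ y ∈ U, InW y (s y))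
    (hy : y ∈ U) (v : TangentSpace I y) : (wConnection g s y v).2 (e₁ y) (e₂ y) =
      mvfderiv I (fun y ↦ (s y).2 (e₁ y) (e₂ y)) y v + frameCurvature g e₁ e₂ y *
      (g.inner y v (e₂ y) * (s y).1 (e₁ y) - g.inner y v (e₁ y) * (s y).1 (e₂ y)) := by
  simp only [wConnection, sub_apply]
  rw [h.bilinDeriv₁₂ hs hW hy, h.curvatureTerm_apply hy, h.inner₁₁ y hy, h.inner₁₂ y hy,
    h.inner₂₁ y hy, h.inner₂₂ y hy]
  ring

theorem contMDiffOn_comp₁ (hs : SmoothWSectionOn s U) : CMDiff[U] ∞ (fun y ↦ (s y).1 (e₁ y)) :=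
  contMDiffOn_covector_apply hs.1 h.smooth₁

theorem contMDiffOn_comp₂ (hs : SmoothWSectionOn s U) : CMDiff[U] ∞ (fun y ↦ (s y).1 (e₂ y)) :=
  contMDiffOn_covector_apply hs.1 h.smooth₂

theorem contMDiffOn_comp₃ (hs : SmoothWSectionOn s U) :
    CMDiff[U] ∞ (fun y ↦ (s y).2 (e₁ y) (e₂ y)) :=
  contMDiffOn_covector_apply (contMDiffOn_bilin_apply hs.2 h.smooth₁) h.smooth₂

theorem smooth_wConnection (hs : SmoothWSectionOn s U) (hW : ∀ y ∈ U, InW y (s y))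
    (hX : CMDiff[U] ∞ (T% X)) : SmoothWSectionOn (fun y ↦ wConnection g s y (X y)) U := by
  have h1 := h.contMDiffOn_comp₁ hs
  have h2 := h.contMDiffOn_comp₂ hs
  have h3 := h.contMDiffOn_comp₃ hs
  have hω := h.contMDiffOn_connForm hX
  have hX1 := contMDiffOn_inner g hX h.smooth₁
  have hX2 := contMDiffOn_inner g hX h.smooth₂
  refine h.smoothWSectionOn (fun y hy ↦ h.inW_wConnection hs hW hy _) ?_ ?_ ?_
  · exact (((h.contMDiffOn_dirDeriv hX h1).sub (hω.mul h2)).sub (hX2.mul h3)).congr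
      fun y hy ↦ h.wConnection₁ hs hW hy _
  · exact (((h.contMDiffOn_dirDeriv hX h2).add (hω.mul h1)).add (hX1.mul h3)).congr
      fun y hy ↦ h.wConnection₂ hs hW hy _
  · exact ((h.contMDiffOn_dirDeriv hX h3).add (h.contMDiffOn_frameCurvature.mul
      ((hX2.mul h1).sub (hX1.mul h2)))).congr fun y hy ↦ h.wConnection₃ hs hW hy _

/-- The curvature of the connection on `W` maps `(K, L)` to `K(∂c)` times the area form. -/
theorem curvatureField_wConnection (hs : SmoothWSectionOn s U) (hW : ∀ y ∈ U, InW y (s y))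
    (hy : y ∈ U) : (curvatureField (wConnection g) e₁ e₂ s y).2 (e₁ y) (e₂ y) =
      (s y).1 (e₁ y) * dirDeriv e₁ (frameCurvature g e₁ e₂) y
      + (s y).1 (e₂ y) * dirDeriv e₂ (frameCurvature g e₁ e₂) y := by
  have h1 := h.contMDiffOn_comp₁ hs
  have h2 := h.contMDiffOn_comp₂ hs
  have h3 := h.contMDiffOn_comp₃ hs
  have hc := h.contMDiffOn_frameCurvature
  have W1 := fun y hy ↦ h.inW_wConnection (y := y) hs hW hy (e₁ y)
  have W2 := fun y hy ↦ h.inW_wConnection (y := y) hs hW hy (e₂ y)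
  have b := h.dirDeriv_dirDeriv h3 hy
  -- The third component of `∇_{e₁} s` is `e₁ l - c k₂`, that of `∇_{e₂} s` is `e₂ l + c k₁`. The
  -- derivatives of `c` in the result come from the product rule here and in `d2`; all other terms
  -- cancel against the curvature term of `∇` and the commutator relation `b`.
  have d1 : dirDeriv e₂ (fun y ↦ (wConnection g s y (e₁ y)).2 (e₁ y) (e₂ y)) y =
      dirDeriv e₂ (dirDeriv e₁ (fun y ↦ (s y).2 (e₁ y) (e₂ y))) y
      - (frameCurvature g e₁ e₂ y * dirDeriv e₂ (fun y ↦ (s y).1 (e₂ y)) y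
        + (s y).1 (e₂ y) * dirDeriv e₂ (frameCurvature g e₁ e₂) y) := by
    rw [← h.dirDeriv_mul hc h2 hy,
      ← h.dirDeriv_sub (h.contMDiffOn_dirDeriv h.smooth₁ h3) (contMDiffOn_mul hc h2) hy]
    refine dirDeriv_congr h.isOpen (fun z hz ↦ ?_) hy
    rw [h.wConnection₃ hs hW hz, h.inner₁₁ z hz, h.inner₁₂ z hz]
    simp only [dirDeriv]
    ring
  have d2 : dirDeriv e₁ (fun y ↦ (wConnection g s y (e₂ y)).2 (e₁ y) (e₂ y)) y =
      dirDeriv e₁ (dirDeriv e₂ (fun y ↦ (s y).2 (e₁ y) (e₂ y))) y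
      + (frameCurvature g e₁ e₂ y * dirDeriv e₁ (fun y ↦ (s y).1 (e₁ y)) y
        + (s y).1 (e₁ y) * dirDeriv e₁ (frameCurvature g e₁ e₂) y) := by
    rw [← h.dirDeriv_mul hc h1 hy,
      ← h.dirDeriv_add (h.contMDiffOn_dirDeriv h.smooth₂ h3) (contMDiffOn_mul hc h1) hy]
    refine dirDeriv_congr h.isOpen (fun z hz ↦ ?_) hy
    rw [h.wConnection₃ hs hW hz, h.inner₂₁ z hz, h.inner₂₂ z hz]
    simp only [dirDeriv]
    ring
  simp only [curvatureField, Prod.snd_sub, sub_apply]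
  rw [h.wConnection₃ (h.smooth_wConnection hs hW h.smooth₁) W1 hy,
    h.wConnection₃ (h.smooth_wConnection hs hW h.smooth₂) W2 hy, h.wConnection₃ hs hW hy,
    h.wConnection₁ hs hW hy, h.wConnection₂ hs hW hy, h.mlieBracket_frame hy]
  change dirDeriv e₁ _ y + _ - (dirDeriv e₂ _ y + _) - _ = _
  rw [d1, d2]
  simp only [map_sub, map_smul, sub_apply, smul_apply, smul_eq_mul, h.inner₁₁ y hy, h.inner₁₂ y hy,
    h.inner₂₁ y hy, h.inner₂₂ y hy, h.wConnection₁ hs hW hy, h.wConnection₂ hs hW hy]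
  simp only [dirDeriv, conn₁, conn₂] at b ⊢
  linear_combination b

end IsOrthonormalFrameOn

end

/-! ### Killing fields as parallel sections, and the pointwise algebra -/

section
variable {E : Type*} [NormedAddCommGroup E] [NormedSpace ℝ E] [FiniteDimensional ℝ E]
  {H : Type*} [TopologicalSpace H] {I : ModelWithCorners ℝ E H}
  {M : Type*} [TopologicalSpace M] [ChartedSpace H M] [IsManifold I ∞ M]
  {g : ContMDiffRiemannianMetric I ∞ E (TangentSpace I : M → Type _)}
  {e₁ e₂ X Y Z : Π x : M, TangentSpace I x} {U : Set M} {x y : M} {f f' : M → ℝ}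
  {K K' : Π x : M, TangentSpace I x →L[ℝ] ℝ}
  {s : Π x : M, WFiber I x}

variable (g K) in
/-- The section `(K_a, K_{a;b})` of `T*M ⊕ (T*M ⊗ T*M)`. -/
def prolongation (y : M) : WFiber I y := (K y, swap (covectorDeriv (leviCivita g) K y))

theorem IsKillingField.inW_prolongation (hK : IsKillingField g K) (y : M) :
    InW y (prolongation g K y) := by
  intro v
  have := hK.2 y v v
  simp only [prolongation, swap_apply]
  linarith

namespace IsOrthonormalFrameOn

variable (h : IsOrthonormalFrameOn g e₁ e₂ U)
include h

theorem smooth_prolongation (hK : IsKillingField g K) :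
    SmoothWSectionOn (prolongation g K) U := by
  have hKU : SmoothCovectorOn U K := hK.1.contMDiffOn
  have h1 := contMDiffOn_covector_apply hKU h.smooth₁
  have h2 := contMDiffOn_covector_apply hKU h.smooth₂
  refine h.smoothWSectionOn (fun y _ ↦ hK.inW_prolongation y) h1 h2 ?_
  exact ((h.contMDiffOn_dirDeriv h.smooth₂ h1).sub
    ((h.contMDiffOn_connForm h.smooth₂).mul h2)).congr fun y hy ↦ h.covectorDeriv₁ hKU hy _

/-- The prolongation of a Killing field is parallel. -/
theorem wConnection_prolongation (hK : IsKillingField g K) (hy : y ∈ U) (v : TangentSpace I y) :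
    wConnection g (prolongation g K) y v = 0 := by
  have hKU : SmoothCovectorOn U K := hK.1.contMDiffOn
  have hs := h.smooth_prolongation hK
  have hW : ∀ y ∈ U, InW y (prolongation g K y) := fun y _ ↦ hK.inW_prolongation y
  have s1 := h.contMDiffOn_comp₁ hs
  have s2 := h.contMDiffOn_comp₂ hs
  have s3 := h.contMDiffOn_comp₃ hs
  have c1 := h.contMDiffOn_conn₁
  have c2 := h.contMDiffOn_conn₂
  -- The first component vanishes by the choice `L_{ab} = K_{a;b}`. The second is the identity
  -- expressing second derivatives of a Killing field by curvature.
  have hfst : (wConnection g (prolongation g K) y v).1 = 0 := by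
    ext u
    simp [wConnection, prolongation]
  refine h.wFiber_ext hy (h.inW_wConnection hs hW hy v) (fun _ ↦ rfl) (by rw [hfst]; rfl)
    (by rw [hfst]; rfl) ?_
  set k₁ := fun y ↦ (prolongation g K y).1 (e₁ y) with hk₁
  set k₂ := fun y ↦ (prolongation g K y).1 (e₂ y) with hk₂
  set l := fun y ↦ (prolongation g K y).2 (e₁ y) (e₂ y) with hl
  have e11 : ∀ z ∈ U, dirDeriv e₁ k₁ z = conn₁ g e₁ e₂ z * k₂ z := by
    intro z hz
    have a := h.covectorDeriv₁ hKU hz (e₁ z)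
    have b := hK.2 z (e₁ z) (e₁ z)
    simp only [dirDeriv, conn₁, hk₁, hk₂, prolongation]
    linarith
  have e22 : ∀ z ∈ U, dirDeriv e₂ k₂ z = -(conn₂ g e₁ e₂ z * k₁ z) := by
    intro z hz
    have a := h.covectorDeriv₂ hKU hz (e₂ z)
    have b := hK.2 z (e₂ z) (e₂ z)
    simp only [dirDeriv, conn₂, hk₁, hk₂, prolongation]
    linarith
  have e21 : ∀ z ∈ U, dirDeriv e₂ k₁ z = l z + conn₂ g e₁ e₂ z * k₂ z := by
    intro z hz
    have a := h.covectorDeriv₁ hKU hz (e₂ z)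
    simp only [dirDeriv, conn₂, hk₁, hk₂, hl, prolongation, swap_apply]
    linarith
  have e12 : ∀ z ∈ U, dirDeriv e₁ k₂ z = -(l z + conn₁ g e₁ e₂ z * k₁ z) := by
    intro z hz
    have a := h.covectorDeriv₂ hKU hz (e₁ z)
    have b := hK.2 z (e₁ z) (e₂ z)
    simp only [dirDeriv, conn₁, hk₁, hk₂, hl, prolongation, swap_apply]
    linarith
  -- Integrability of the Killing system `e11`, `e22`, `e21`, `e12`: the commutator relation for
  -- `k₁` determines `e₁ l`, the one for `k₂` determines `e₂ l`.
  have b1 := h.dirDeriv_dirDeriv s1 hy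
  have b2 := h.dirDeriv_dirDeriv s2 hy
  rw [dirDeriv_congr h.isOpen e21 hy, dirDeriv_congr h.isOpen e11 hy,
    h.dirDeriv_add s3 (contMDiffOn_mul c2 s2) hy, h.dirDeriv_mul c2 s2 hy, h.dirDeriv_mul c1 s2 hy,
    e11 y hy, e21 y hy, e12 y hy, e22 y hy] at b1
  rw [dirDeriv_congr h.isOpen e22 hy, dirDeriv_congr h.isOpen e12 hy, dirDeriv_neg, dirDeriv_neg,
    h.dirDeriv_add s3 (contMDiffOn_mul c1 s1) hy, h.dirDeriv_mul c2 s1 hy, h.dirDeriv_mul c1 s1 hy,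
    e11 y hy, e21 y hy, e12 y hy, e22 y hy] at b2
  have r1 : dirDeriv e₁ l y = frameCurvature g e₁ e₂ y * k₂ y := by
    simp only [frameCurvature]
    linear_combination b1
  have r2 : dirDeriv e₂ l y = - (frameCurvature g e₁ e₂ y * k₁ y) := by
    simp only [frameCurvature]
    linear_combination b2
  rw [h.wConnection₃ hs hW hy, h.apply_eq hy (mvfderiv I _ y) v]
  change g.inner y v (e₁ y) • dirDeriv e₁ l y + g.inner y v (e₂ y) • dirDeriv e₂ l y + _ = 0
  rw [r1, r2]
  simp only [smul_eq_mul, hk₁, hk₂]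
  ring

/-- Algebraic core: a nonzero element of `ker α` at a point where `dc ≠ 0` forces `D_{∂c} dc` to
be proportional to `dc`. -/
theorem hessian_parallel (hf : CMDiff[U] ∞ f) (hs : SmoothWSectionOn s U)
    (hW : ∀ y ∈ U, InW y (s y)) (hy : y ∈ U)
    (hker : ∀ z ∈ U, (s z).1 (e₁ z) * dirDeriv e₁ f z + (s z).1 (e₂ z) * dirDeriv e₂ f z = 0)
    (hder : ∀ v, (wConnection g s y v).1 (e₁ y) * dirDeriv e₁ f y
      + (wConnection g s y v).1 (e₂ y) * dirDeriv e₂ f y = 0) (hne : s y ≠ 0) :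
    dirDeriv e₁ f y * (dirDeriv e₁ f y * (dirDeriv e₁ (dirDeriv e₂ f) y
        + conn₁ g e₁ e₂ y * dirDeriv e₁ f y)
      + dirDeriv e₂ f y * (dirDeriv e₂ (dirDeriv e₂ f) y
        + conn₂ g e₁ e₂ y * dirDeriv e₁ f y)) =
    dirDeriv e₂ f y * (dirDeriv e₁ f y * (dirDeriv e₁ (dirDeriv e₁ f) y
        - conn₁ g e₁ e₂ y * dirDeriv e₂ f y)
      + dirDeriv e₂ f y * (dirDeriv e₂ (dirDeriv e₁ f) y
        - conn₂ g e₁ e₂ y * dirDeriv e₂ f y)) := by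
  have s1 := h.contMDiffOn_comp₁ hs
  have s2 := h.contMDiffOn_comp₂ hs
  have f1 := h.contMDiffOn_dirDeriv h.smooth₁ hf
  have f2 := h.contMDiffOn_dirDeriv h.smooth₂ hf
  -- The derivative of the identity `k(∂f) = 0`, which holds on all of `U`.
  have hdiff : ∀ V : Π x : M, TangentSpace I x,
      ((s y).1 (e₁ y) * dirDeriv V (dirDeriv e₁ f) y
        + dirDeriv e₁ f y * dirDeriv V (fun y ↦ (s y).1 (e₁ y)) y)
      + ((s y).1 (e₂ y) * dirDeriv V (dirDeriv e₂ f) y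
        + dirDeriv e₂ f y * dirDeriv V (fun y ↦ (s y).1 (e₂ y)) y) = 0 := by
    intro V
    rw [← h.dirDeriv_mul s1 f1 hy, ← h.dirDeriv_mul s2 f2 hy,
      ← h.dirDeriv_add (contMDiffOn_mul s1 f1) (contMDiffOn_mul s2 f2) hy,
      dirDeriv_congr h.isOpen hker hy, dirDeriv_const]
  have hd1 := hdiff e₁
  have hd2 := hdiff e₂
  have hp1 := hder (e₁ y)
  have hp2 := hder (e₂ y)
  rw [h.wConnection₁ hs hW hy, h.wConnection₂ hs hW hy, h.inner₁₁ y hy, h.inner₁₂ y hy] at hp1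
  rw [h.wConnection₁ hs hW hy, h.wConnection₂ hs hW hy, h.inner₂₁ y hy, h.inner₂₂ y hy] at hp2
  have hk := hker y hy
  by_cases hc : dirDeriv e₁ f y = 0 ∧ dirDeriv e₂ f y = 0
  · simp [hc.1, hc.2]
  -- If `k` vanishes at `y`, comparing `hdiff` with `hder` leaves `l · df = 0`; as `df ≠ 0`, also `l
  -- = 0` and `s y = 0`.
  have key : ¬((s y).1 (e₁ y) = 0 ∧ (s y).1 (e₂ y) = 0) := by
    rintro ⟨hk1, hk2⟩
    refine hne (h.wFiber_ext hy (hW y hy) (fun _ ↦ rfl) hk1 hk2 ?_)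
    rw [hk1, hk2] at hd1 hd2 hp1 hp2
    change _ = (0 : ℝ)
    by_contra hl
    refine hc ⟨?_, ?_⟩
    · refine (mul_eq_zero.1 (?_ : (s y).2 (e₁ y) (e₂ y) * dirDeriv e₁ f y = 0)).resolve_left hl
      simp only [dirDeriv] at *
      linear_combination hd2 - hp2
    · refine (mul_eq_zero.1 (?_ : (s y).2 (e₁ y) (e₂ y) * dirDeriv e₂ f y = 0)).resolve_left hl
      simp only [dirDeriv] at *
      linear_combination hp1 - hd1
  rw [← sub_eq_zero]
  simp only [dirDeriv, conn₁, conn₂] at *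
  -- This is `k(D_{∂f} ∂f) = 0`. Weighting the two directions by the components of `∂f` makes the
  -- terms in `l` cancel, since `L(∂f, ∂f) = 0`.
  have kb : (s y).1 (e₁ y) * (mvfderiv I f y (e₁ y) * (mvfderiv I (dirDeriv e₁ f) y (e₁ y)
        - connForm g e₁ e₂ y (e₁ y) * mvfderiv I f y (e₂ y))
      + mvfderiv I f y (e₂ y) * (mvfderiv I (dirDeriv e₁ f) y (e₂ y)
        - connForm g e₁ e₂ y (e₂ y) * mvfderiv I f y (e₂ y)))
    + (s y).1 (e₂ y) * (mvfderiv I f y (e₁ y) * (mvfderiv I (dirDeriv e₂ f) y (e₁ y)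
        + connForm g e₁ e₂ y (e₁ y) * mvfderiv I f y (e₁ y))
      + mvfderiv I f y (e₂ y) * (mvfderiv I (dirDeriv e₂ f) y (e₂ y)
        + connForm g e₁ e₂ y (e₂ y) * mvfderiv I f y (e₁ y))) = 0 := by
    linear_combination mvfderiv I f y (e₁ y) * (hd1 - hp1) + mvfderiv I f y (e₂ y) * (hd2 - hp2)
  -- Both `∂f` and `D_{∂f} ∂f` are in the kernel of `k`. By Cramer's rule their determinant times
  -- either component of `k` is zero, and one component is not.
  rcases not_and_or.1 key with hk0 | hk0 <;> refine (mul_eq_zero.1 ?_).resolve_left hk0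
  · linear_combination (mvfderiv I f y (e₁ y) * (mvfderiv I (dirDeriv e₂ f) y (e₁ y)
        + connForm g e₁ e₂ y (e₁ y) * mvfderiv I f y (e₁ y))
      + mvfderiv I f y (e₂ y) * (mvfderiv I (dirDeriv e₂ f) y (e₂ y)
        + connForm g e₁ e₂ y (e₂ y) * mvfderiv I f y (e₁ y))) * hk - mvfderiv I f y (e₂ y) * kb
  · linear_combination mvfderiv I f y (e₁ y) * kb - (mvfderiv I f y (e₁ y) *
        (mvfderiv I (dirDeriv e₁ f) y (e₁ y)
        - connForm g e₁ e₂ y (e₁ y) * mvfderiv I f y (e₂ y))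
      + mvfderiv I f y (e₂ y) * (mvfderiv I (dirDeriv e₁ f) y (e₂ y)
        - connForm g e₁ e₂ y (e₂ y) * mvfderiv I f y (e₂ y))) * hk

end IsOrthonormalFrameOn

end

/-! ### Existence of orthonormal frames; the Gaussian curvature -/

section
variable {E : Type*} [NormedAddCommGroup E] [NormedSpace ℝ E] [FiniteDimensional ℝ E]
  {H : Type*} [TopologicalSpace H] {I : ModelWithCorners ℝ E H}
  {M : Type*} [TopologicalSpace M] [ChartedSpace H M] [IsManifold I ∞ M]
  (g : ContMDiffRiemannianMetric I ∞ E (TangentSpace I : M → Type _))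
  {X Y : Π x : M, TangentSpace I x} {U : Set M}

/-- The unit vector field in the direction of `X`. -/
def normalize (X : Π x : M, TangentSpace I x) (y : M) : TangentSpace I y :=
  (√(g.inner y (X y) (X y)))⁻¹ • X y

theorem inner_normalize_self {y : M} (hX : X y ≠ 0) :
    g.inner y (normalize g X y) (normalize g X y) = 1 := by
  have h := g.pos y (X y) hX
  have h1 := Real.mul_self_sqrt h.le
  have h2 : √(g.inner y (X y) (X y)) ≠ 0 := (Real.sqrt_pos.2 h).ne'
  simp only [normalize, map_smul, smul_apply, smul_eq_mul]
  field_simp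
  linarith

theorem contMDiffOn_normalize (hX : CMDiff[U] ∞ (T% X)) (h0 : ∀ y ∈ U, X y ≠ 0) :
    CMDiff[U] ∞ (T% (normalize g X)) := by
  refine ContMDiffOn.smul_section (f := fun y ↦ (√(g.inner y (X y) (X y)))⁻¹) ?_ hX
  intro y hy
  have h := g.pos y (X y) (h0 y hy)
  have h1 : ContDiffAt ℝ ∞ (fun t : ℝ ↦ (√t)⁻¹) (g.inner y (X y) (X y)) :=
    (Real.contDiffAt_sqrt h.ne').inv (Real.sqrt_pos.2 h).ne'
  exact ContMDiffAt.comp_contMDiffWithinAt (g := fun t : ℝ ↦ (√t)⁻¹) y h1.contMDiffAt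
    (contMDiffOn_inner g hX hX y hy)

/-- Orthogonal pairs of unit vectors span the tangent plane of a surface. -/
theorem decomp_of_orthonormal (hE : Module.finrank ℝ E = 2) {y : M} {a b : TangentSpace I y}
    (haa : g.inner y a a = 1) (hab : g.inner y a b = 0) (hbb : g.inner y b b = 1)
    (v : TangentSpace I y) : v = g.inner y v a • a + g.inner y v b • b := by
  have hba : g.inner y b a = 0 := by rw [g.symm]; exact hab
  have hli : LinearIndependent ℝ ![a, b] := by
    rw [LinearIndependent.pair_iff]
    intro s t hst
    have h1 := congrArg (fun w ↦ g.inner y w a) hst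
    have h2 := congrArg (fun w ↦ g.inner y w b) hst
    simp [haa, hab, hba, hbb] at h1 h2
    exact ⟨h1, h2⟩
  have hspan := hli.span_eq_top_of_card_eq_finrank (by
    rw [Fintype.card_fin]; exact hE.symm)
  have hv : v ∈ Submodule.span ℝ (Set.range ![a, b]) := hspan ▸ Submodule.mem_top
  rw [Matrix.range_cons, Matrix.range_cons, Matrix.range_empty, Set.union_empty] at hv
  obtain ⟨s, t, rfl⟩ := Submodule.mem_span_pair.1 hv
  simp [haa, hab, hba, hbb]

/-- Gram–Schmidt applied to the frame of a local trivialization. -/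
theorem exists_isOrthonormalFrameOn (hE : Module.finrank ℝ E = 2) (x : M) :
    ∃ (U : Set M) (e₁ e₂ : Π y : M, TangentSpace I y), x ∈ U ∧
      IsOrthonormalFrameOn g e₁ e₂ U := by
  set t := trivializationAt E (TangentSpace I : M → Type _) x
  let b : Module.Basis (Fin 2) ℝ E := (Module.finBasis ℝ E).reindex (finCongr hE)
  have hf := t.isLocalFrameOn_localFrame_baseSet I ∞ b
  set F := t.localFrame b
  set U := t.baseSet
  have hli : ∀ y ∈ U, LinearIndependent ℝ ![F 0 y, F 1 y] := by
    intro y hy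
    have heq : ![F 0 y, F 1 y] = fun i ↦ F i y := by
      funext i
      fin_cases i <;> rfl
    rw [heq]
    exact hf.linearIndependent hy
  have h0 : ∀ y ∈ U, F 0 y ≠ 0 := fun y hy ↦ (hli y hy).ne_zero 0
  set e₁ := normalize g (F 0)
  have s1 : CMDiff[U] ∞ (T% e₁) := contMDiffOn_normalize g (hf.contMDiffOn 0) h0
  have h11 : ∀ y ∈ U, g.inner y (e₁ y) (e₁ y) = 1 := fun y hy ↦ inner_normalize_self g (h0 y hy)
  let G : Π y : M, TangentSpace I y := F 1 - (fun y ↦ g.inner y (F 1 y) (e₁ y)) • e₁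
  have sG : CMDiff[U] ∞ (T% G) := (hf.contMDiffOn 1).sub_section
    ((contMDiffOn_inner g (hf.contMDiffOn 1) s1).smul_section s1)
  have hG1 : ∀ y ∈ U, g.inner y (e₁ y) (G y) = 0 := by
    intro y hy
    rw [g.symm]
    simp [G, h11 y hy]
  -- `G y = 0` would be a linear relation between `F 0` and `F 1` in which `F 1` has coefficient
  -- `1`.
  have hG0 : ∀ y ∈ U, G y ≠ 0 := by
    intro y hy hG
    have := (LinearIndependent.pair_iff.1 (hli y hy))
      (-(g.inner y (F 1 y) (e₁ y) * (√(g.inner y (F 0 y) (F 0 y)))⁻¹)) 1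
      (by rw [← hG]; simp [G, e₁, normalize]; module)
    exact one_ne_zero this.2
  have h22 : ∀ y ∈ U, g.inner y (normalize g G y) (normalize g G y) = 1 :=
    fun y hy ↦ inner_normalize_self g (hG0 y hy)
  have h12 : ∀ y ∈ U, g.inner y (e₁ y) (normalize g G y) = 0 := by
    intro y hy
    simp [normalize, hG1 y hy]
  exact ⟨U, e₁, normalize g G, FiberBundle.mem_baseSet_trivializationAt' x, t.open_baseSet, s1,
    contMDiffOn_normalize g sG hG0, h11, h12, h22,
    fun y hy v ↦ decomp_of_orthonormal g hE (h11 y hy) (h12 y hy) (h22 y hy) v⟩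

variable {g} {e₁ e₂ : Π x : M, TangentSpace I x} {y : M}

/-- The numerator is the curvature times the squared determinant of `u, v` in the frame; the
denominator is the same square by Lagrange's identity. -/
theorem IsOrthonormalFrameOn.sectionalCurvature_eq (h : IsOrthonormalFrameOn g e₁ e₂ U)
    (hy : y ∈ U) {u v : TangentSpace I y} (huv : LinearIndependent ℝ ![u, v]) :
    sectionalCurvature g y u v = frameCurvature g e₁ e₂ y := by
  set u₁ := g.inner y u (e₁ y)
  set u₂ := g.inner y u (e₂ y)
  set v₁ := g.inner y v (e₁ y)
  set v₂ := g.inner y v (e₂ y)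
  have hdet : u₁ * v₂ - u₂ * v₁ ≠ 0 := by
    intro hd
    have key : ∀ s t : ℝ, s * u₁ + t * v₁ = 0 → s * u₂ + t * v₂ = 0 → s = 0 ∧ t = 0 := by
      intro s t h1 h2
      refine LinearIndependent.pair_iff.1 huv s t (h.ext hy ?_ ?_)
      · simpa using h1
      · simpa using h2
    have k1 := key v₁ (-u₁) (by ring) (by linarith)
    have k2 := key v₂ (-u₂) (by linarith) (by ring)
    exact one_ne_zero (key 1 0 (by linarith [k1.2]) (by linarith [k2.2])).1
  have expand : ∀ a c : TangentSpace I y, g.inner y a c =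
      g.inner y a (e₁ y) * g.inner y c (e₁ y) + g.inner y a (e₂ y) * g.inner y c (e₂ y) := by
    intro a c
    rw [h.apply_eq hy (g.inner y a) c]
    simp
    ring
  rw [sectionalCurvature, h.riemann_apply hy, expand u u, expand v v, expand u v, map_smul,
    smul_apply, map_sub, sub_apply, map_smul, map_smul, smul_apply, smul_apply,
    g.symm y (e₁ y) u, g.symm y (e₂ y) u]
  simp only [smul_eq_mul]
  rw [div_eq_iff]
  · ring
  · have : (u₁ * u₁ + u₂ * u₂) * (v₁ * v₁ + v₂ * v₂) - (u₁ * v₁ + u₂ * v₂) ^ 2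
      = (u₁ * v₂ - u₂ * v₁) ^ 2 := by ring
    rw [this]
    exact pow_ne_zero 2 hdet

theorem IsOrthonormalFrameOn.gradient_eq {f : M → ℝ} (h : IsOrthonormalFrameOn g e₁ e₂ U)
    (hy : y ∈ U) : gradient g f y = dirDeriv e₁ f y • e₁ y + dirDeriv e₂ f y • e₂ y := by
  refine h.ext hy ?_ ?_
  · rw [gradient, inner_flat_symm]
    simp [h.inner₁₁ y hy, h.inner₂₁ y hy, dirDeriv]
  · rw [gradient, inner_flat_symm]
    simp [h.inner₁₂ y hy, h.inner₂₂ y hy, dirDeriv]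

end

/-! ### Killing fields in the derived flag -/

section
variable {M : Type*} [TopologicalSpace M] [ChartedSpace (EuclideanSpace ℝ (Fin 2)) M]
  [IsManifold (𝓡 2) ∞ M]
  {g : ContMDiffRiemannianMetric (𝓡 2) ∞ (EuclideanSpace ℝ (Fin 2))
    (TangentSpace (𝓡 2) : M → Type _)}
  {e₁ e₂ : Π x : M, TangentSpace (𝓡 2) x} {U : Set M} {x y : M}
  {K : Π x : M, TangentSpace (𝓡 2) x →L[ℝ] ℝ}

theorem IsOrthonormalFrameOn.gaussianCurvature_eq (h : IsOrthonormalFrameOn g e₁ e₂ U)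
    (hy : y ∈ U) : gaussianCurvature g y = frameCurvature g e₁ e₂ y := by
  refine h.sectionalCurvature_eq hy ?_
  have := (EuclideanSpace.basisFun (Fin 2) ℝ).toBasis.linearIndependent
  have heq : (EuclideanSpace.basisFun (Fin 2) ℝ).toBasis =
      ![EuclideanSpace.single (0 : Fin 2) (1 : ℝ), EuclideanSpace.single (1 : Fin 2) (1 : ℝ)] := by
    funext i
    fin_cases i <;> simp
  rw [heq] at this
  exact this

theorem IsOrthonormalFrameOn.contMDiffOn_gaussianCurvature (h : IsOrthonormalFrameOn g e₁ e₂ U) :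
    ContMDiffOn (𝓡 2) 𝓘(ℝ) ∞ (gaussianCurvature g) U :=
  h.contMDiffOn_frameCurvature.congr fun _ hy ↦ h.gaussianCurvature_eq hy

/-- The vanishing of `F` is tested on the frame fields, and its Λ² component is read off. -/
theorem IsOrthonormalFrameOn.curvatureKernel_subset (h : IsOrthonormalFrameOn g e₁ e₂ U)
    (hy : y ∈ U) {w : WFiber (𝓡 2) y} (hw : w ∈ curvatureKernel g y) :
    InW y w ∧ w.1 (e₁ y) * dirDeriv e₁ (gaussianCurvature g) y
      + w.1 (e₂ y) * dirDeriv e₂ (gaussianCurvature g) y = 0 := by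
  obtain ⟨V, s, hyV, ⟨hV, hs, hW⟩, rfl, hF⟩ := hw
  refine ⟨hW y hyV, ?_⟩
  have h' := h.mono (hV.inter h.isOpen) Set.inter_subset_right
  have hcurv := hF e₁ e₂ ((h.smooth₁ y hy).contMDiffAt (h.isOpen.mem_nhds hy))
    ((h.smooth₂ y hy).contMDiffAt (h.isOpen.mem_nhds hy))
  have key := h'.curvatureField_wConnection (s := s) (y := y)
    ⟨hs.1.mono Set.inter_subset_left, hs.2.mono Set.inter_subset_left⟩
    (fun z hz ↦ hW z hz.1) ⟨hyV, hy⟩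
  rw [hcurv] at key
  rw [dirDeriv_congr h.isOpen (fun z hz ↦ h.gaussianCurvature_eq hz) hy,
    dirDeriv_congr h.isOpen (fun z hz ↦ h.gaussianCurvature_eq hz) hy, ← key]
  rfl

theorem IsKillingField.smooth_prolongation (hK : IsKillingField g K) :
    SmoothWSectionOn (prolongation g K) Set.univ := by
  have hl : ∀ x : M, ∃ U ∈ 𝓝 x, SmoothWSectionOn (prolongation g K) U := by
    intro x
    obtain ⟨U, e₁, e₂, hx, h⟩ := exists_isOrthonormalFrameOn g (by simp) x
    exact ⟨U, h.isOpen.mem_nhds hx, h.smooth_prolongation hK⟩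
  constructor <;> intro x _ <;> obtain ⟨U, hU, hs⟩ := hl x
  · exact (hs.1.contMDiffAt hU).contMDiffWithinAt
  · exact (hs.2.contMDiffAt hU).contMDiffWithinAt

theorem IsKillingField.wConnection_prolongation (hK : IsKillingField g K) (x : M)
    (v : TangentSpace (𝓡 2) x) : wConnection g (prolongation g K) x v = 0 := by
  obtain ⟨U, e₁, e₂, hx, h⟩ := exists_isOrthonormalFrameOn g (by simp) x
  exact h.wConnection_prolongation hK hx v

theorem covectorDeriv_zero (x : M) : covectorDeriv (leviCivita g)
    (fun x ↦ (0 : TangentSpace (𝓡 2) x →L[ℝ] ℝ)) x = 0 := by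
  ext v u
  have := covectorDeriv_apply (leviCivita g) (x := x)
    (K := fun x ↦ (0 : TangentSpace (𝓡 2) x →L[ℝ] ℝ))
    ((contMDiff_zeroSection (n := ∞) ℝ (fun x : M ↦ TangentSpace (𝓡 2) x →L[ℝ] ℝ)
      (IB := 𝓡 2)).contMDiffAt.mdifferentiableAt (by simp))
    (mdifferentiableAt_extend (𝓡 2) (EuclideanSpace ℝ (Fin 2)) u) v
  simpa [mvfderiv_const] using this

theorem isKillingField_zero :
    IsKillingField g (fun x ↦ (0 : TangentSpace (𝓡 2) x →L[ℝ] ℝ)) := by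
  refine ⟨contMDiff_zeroSection ℝ _, fun x a b ↦ ?_⟩
  simp [covectorDeriv_zero]

theorem prolongation_zero :
    prolongation g (fun x ↦ (0 : TangentSpace (𝓡 2) x →L[ℝ] ℝ)) = fun _ ↦ 0 := by
  funext x
  refine Prod.ext rfl ?_
  ext u v
  simp [prolongation, covectorDeriv_zero]

/-- The zero section is the prolongation of the zero Killing field, hence parallel. -/
theorem wConnection_zero (x : M) (v : TangentSpace (𝓡 2) x) :
    wConnection g (fun x ↦ (0 : WFiber (𝓡 2) x)) x v = 0 := by
  rw [← prolongation_zero (g := g)]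
  exact isKillingField_zero.wConnection_prolongation x v

theorem IsKillingField.mem_curvatureKernel (hK : IsKillingField g K) (x : M) :
    prolongation g K x ∈ curvatureKernel g x := by
  refine ⟨Set.univ, prolongation g K, Set.mem_univ x,
    ⟨isOpen_univ, hK.smooth_prolongation, fun y _ ↦ hK.inW_prolongation y⟩, rfl, ?_⟩
  intro A B _ _
  have h0 : ∀ C : Π y : M, TangentSpace (𝓡 2) y,
      (fun y ↦ wConnection g (prolongation g K) y (C y)) = fun _ ↦ 0 :=
    fun C ↦ funext fun y ↦ hK.wConnection_prolongation y _
  rw [curvatureField, h0, h0, wConnection_zero, wConnection_zero, hK.wConnection_prolongation]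
  refine Prod.ext ?_ ?_
  · ext u
    change (0 : ℝ) - 0 - 0 = 0
    ring
  · ext u v
    change (0 : ℝ) - 0 - 0 = 0
    ring

theorem IsKillingField.mem_level (hK : IsKillingField g K) (x : M) :
    prolongation g K x ∈ level (flagV g 0) x :=
  ⟨Set.univ, prolongation g K, Set.mem_univ x,
    ⟨isOpen_univ, hK.smooth_prolongation, fun y _ ↦ hK.mem_curvatureKernel y⟩, rfl⟩

/-- The prolongation is itself a section of `W⁽⁰⁾`, and its derivative `0` lies in `W⁽⁰⁾` as the
prolongation of the zero Killing field. -/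
theorem IsKillingField.mem_flagV_one (hK : IsKillingField g K) (x : M) :
    prolongation g K x ∈ flagV g 1 x := by
  refine ⟨Set.univ, prolongation g K, Set.mem_univ x,
    ⟨isOpen_univ, hK.smooth_prolongation, fun y _ ↦ hK.mem_level y⟩, rfl, fun v ↦ ?_⟩
  rw [hK.wConnection_prolongation]
  have := (isKillingField_zero (g := g)).mem_level x
  rwa [prolongation_zero] at this

end

/-! ### Use of regularity and the conclusion -/

section
variable {M : Type*} [TopologicalSpace M] [ChartedSpace (EuclideanSpace ℝ (Fin 2)) M]
  [IsManifold (𝓡 2) ∞ M]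
  {g : ContMDiffRiemannianMetric (𝓡 2) ∞ (EuclideanSpace ℝ (Fin 2))
    (TangentSpace (𝓡 2) : M → Type _)}
  {e₁ e₂ : Π x : M, TangentSpace (𝓡 2) x} {U : Set M} {x y : M}
  {K : Π x : M, TangentSpace (𝓡 2) x →L[ℝ] ℝ}

theorem level_subset (V : Π x : M, Set (WFiber (𝓡 2) x)) : level V x ⊆ V x := by
  rintro w ⟨U, s, hx, hs, rfl⟩
  exact hs.2.2 x hx

theorem eq_bot_of_finrank_eq_zero {A : Type*} [AddCommMonoid A] [Module ℝ A]
    [Module.Finite ℝ A] {S : Submodule ℝ A} (hS : Module.finrank ℝ S = 0) : S = ⊥ := by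
  let _ := Module.addCommMonoidToAddCommGroup ℝ (M := A)
  exact Submodule.finrank_eq_zero.1 hS

theorem finite_wFiber (x : M) : Module.Finite ℝ (WFiber (𝓡 2) x) := by
  have h1 : Module.Finite ℝ (TangentSpace (𝓡 2) x →L[ℝ] ℝ) :=
    inferInstanceAs (Module.Finite ℝ (EuclideanSpace ℝ (Fin 2) →L[ℝ] ℝ))
  have h2 : Module.Finite ℝ (TangentSpace (𝓡 2) x →L[ℝ] TangentSpace (𝓡 2) x →L[ℝ] ℝ) :=
    inferInstanceAs (Module.Finite ℝ
      (EuclideanSpace ℝ (Fin 2) →L[ℝ] EuclideanSpace ℝ (Fin 2) →L[ℝ] ℝ))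
  exact Module.Finite.prod

/-- A subset of constant rank with a nonzero element over one point has nonzero elements over
every point. -/
theorem HasRank.exists_ne_zero {V : Π x : M, Set (WFiber (𝓡 2) x)} {r : ℕ} (hV : HasRank V r)
    {w : WFiber (𝓡 2) y} (hw : w ∈ V y) (h0 : w ≠ 0) (x : M) : ∃ w' ∈ V x, w' ≠ 0 := by
  have := finite_wFiber (M := M)
  obtain ⟨S, hS, hr⟩ := hV y
  obtain ⟨S', hS', hr'⟩ := hV x
  by_contra! hcon
  have hbot : S' = ⊥ := by
    rw [Submodule.eq_bot_iff]
    intro z hz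
    exact hcon z (hS' ▸ hz)
  rw [hbot, finrank_bot] at hr'
  have hS0 : S = ⊥ := eq_bot_of_finrank_eq_zero (hr.trans hr'.symm)
  rw [← hS, hS0] at hw
  exact h0 hw

/-- The rank of `V⁽¹⁾` is positive at a point where `K ≠ 0`, and it is the same at all points of
`M`, so no connectedness or continuation argument is needed. -/
theorem IsRegular.exists_ne_zero (hreg : IsRegular g) (hK : IsKillingField g K) (h0 : K ≠ 0)
    (x : M) : ∃ w ∈ flagV g 1 x, w ≠ 0 := by
  obtain ⟨y, hy⟩ := Function.ne_iff.1 h0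
  obtain ⟨heq, r, hr⟩ := hreg 1
  rw [heq] at hr
  exact hr.exists_ne_zero (hK.mem_flagV_one y) (fun h ↦ hy (congrArg Prod.fst h)) x

namespace IsOrthonormalFrameOn

variable (h : IsOrthonormalFrameOn g e₁ e₂ U)
include h

theorem hessian_parallel_of_regular (hreg : IsRegular g) (hK : IsKillingField g K) (h0 : K ≠ 0)
    (hx : x ∈ U) {f : M → ℝ} (hf : f = gaussianCurvature g) :
    dirDeriv e₁ f x * (dirDeriv e₁ f x * (dirDeriv e₁ (dirDeriv e₂ f) x
        + conn₁ g e₁ e₂ x * dirDeriv e₁ f x)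
      + dirDeriv e₂ f x * (dirDeriv e₂ (dirDeriv e₂ f) x
        + conn₂ g e₁ e₂ x * dirDeriv e₁ f x)) =
    dirDeriv e₂ f x * (dirDeriv e₁ f x * (dirDeriv e₁ (dirDeriv e₁ f) x
        - conn₁ g e₁ e₂ x * dirDeriv e₂ f x)
      + dirDeriv e₂ f x * (dirDeriv e₂ (dirDeriv e₁ f) x
        - conn₂ g e₁ e₂ x * dirDeriv e₂ f x)) := by
  subst hf
  obtain ⟨w, ⟨V, s, hxV, ⟨hV, hs, hsV⟩, rfl, hder⟩, hne⟩ := hreg.exists_ne_zero hK h0 x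
  have h' := h.mono (hV.inter h.isOpen) Set.inter_subset_right
  -- `s` is a section of `W⁽⁰⁾ ⊆ V⁽⁰⁾` on a whole neighbourhood, so `k(∂c) = 0` may be
  -- differentiated; `∇s` is known to lie in `W⁽⁰⁾` at `x`.
  have hker : ∀ z ∈ V ∩ U, _ :=
    fun z hz ↦ h.curvatureKernel_subset hz.2 (level_subset _ (hsV z hz.1))
  exact h'.hessian_parallel (h'.contMDiffOn_gaussianCurvature)
    ⟨hs.1.mono Set.inter_subset_left, hs.2.mono Set.inter_subset_left⟩
    (fun z hz ↦ (hker z hz).1) ⟨hxV, hx⟩ (fun z hz ↦ (hker z hz).2)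
    (fun v ↦ (h.curvatureKernel_subset hx (level_subset _ (hder v))).2) hne

theorem contMDiffOn_gradient {f : M → ℝ} (hf : ContMDiffOn (𝓡 2) 𝓘(ℝ) ∞ f U) :
    ContMDiffOn (𝓡 2) (𝓡 2).tangent ∞
      (fun y ↦ (⟨y, gradient g f y⟩ : TangentBundle (𝓡 2) M)) U := by
  refine h.contMDiffOn_of_inner ?_ ?_
  · exact (h.contMDiffOn_dirDeriv h.smooth₁ hf).congr fun y _ ↦ inner_flat_symm g y _ _
  · exact (h.contMDiffOn_dirDeriv h.smooth₂ hf).congr fun y _ ↦ inner_flat_symm g y _ _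

theorem smooth_mvfderiv {f : M → ℝ} (hf : ContMDiffOn (𝓡 2) 𝓘(ℝ) ∞ f U) :
    SmoothCovectorOn U (mvfderiv (𝓡 2) f) :=
  h.smoothCovectorOn (h.contMDiffOn_dirDeriv h.smooth₁ hf) (h.contMDiffOn_dirDeriv h.smooth₂ hf)

/-- In dimension two `α ∧ β` is a multiple of the area form, so a single determinant decides. -/
theorem wedge_eq_zero (hy : y ∈ U) {α β : TangentSpace (𝓡 2) y →L[ℝ] ℝ}
    (hαβ : α (e₁ y) * β (e₂ y) = α (e₂ y) * β (e₁ y)) : wedge α β = 0 := by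
  ext u v
  simp only [wedge, sub_apply, ContinuousLinearMap.smulRight_apply, smul_apply, smul_eq_mul,
    zero_apply]
  rw [h.apply_eq hy α u, h.apply_eq hy α v, h.apply_eq hy β u, h.apply_eq hy β v]
  simp only [smul_eq_mul]
  linear_combination (g.inner y u (e₁ y) * g.inner y v (e₂ y)
    - g.inner y u (e₂ y) * g.inner y v (e₁ y)) * hαβ

theorem dirDeriv_gradient {f f' : M → ℝ} (hy : y ∈ U) :
    mvfderiv (𝓡 2) f' y (gradient g f y) =
      dirDeriv e₁ f y * dirDeriv e₁ f' y + dirDeriv e₂ f y * dirDeriv e₂ f' y := by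
  rw [h.gradient_eq hy]
  simp [dirDeriv]

theorem connForm_gradient {f : M → ℝ} (hy : y ∈ U) :
    connForm g e₁ e₂ y (gradient g f y) =
      dirDeriv e₁ f y * conn₁ g e₁ e₂ y + dirDeriv e₂ f y * conn₂ g e₁ e₂ y := by
  rw [h.gradient_eq hy]
  simp [connForm, conn₁, conn₂]

theorem wedge_gaussianCurvature (hreg : IsRegular g) (hK : IsKillingField g K) (h0 : K ≠ 0)
    (hx : x ∈ U) : wedge (mvfderiv (𝓡 2) (gaussianCurvature g) x)
      (covectorDeriv (leviCivita g) (mvfderiv (𝓡 2) (gaussianCurvature g)) x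
        (gradient g (gaussianCurvature g) x)) = 0 := by
  refine h.wedge_eq_zero hx ?_
  have hd := h.smooth_mvfderiv h.contMDiffOn_gaussianCurvature
  have key := h.hessian_parallel_of_regular hreg hK h0 hx rfl
  rw [h.covectorDeriv₁ hd hx, h.covectorDeriv₂ hd hx, h.dirDeriv_gradient hx,
    h.dirDeriv_gradient hx, h.connForm_gradient hx]
  change dirDeriv e₁ _ x * (_ * dirDeriv _ (dirDeriv e₂ _) x + _ * dirDeriv _ (dirDeriv e₂ _) x
    + _ * dirDeriv e₁ _ x) = dirDeriv e₂ _ x * (_ * dirDeriv _ (dirDeriv e₁ _) x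
    + _ * dirDeriv _ (dirDeriv e₁ _) x - _ * dirDeriv e₂ _ x)
  linear_combination key

theorem leviCivita_gradient (hreg : IsRegular g) (hK : IsKillingField g K) (h0 : K ≠ 0)
    (hx : x ∈ U) : ∃ a : ℝ, leviCivita g (gradient g (gaussianCurvature g)) x
      (gradient g (gaussianCurvature g) x) = a • gradient g (gaussianCurvature g) x := by
  have hg := h.contMDiffOn_gradient h.contMDiffOn_gaussianCurvature
  have key := h.hessian_parallel_of_regular hreg hK h0 hx rfl
  have i1 : (fun y ↦ g.inner y (gradient g (gaussianCurvature g) y) (e₁ y)) =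
      dirDeriv e₁ (gaussianCurvature g) := funext fun y ↦ inner_flat_symm g y _ _
  have i2 : (fun y ↦ g.inner y (gradient g (gaussianCurvature g) y) (e₂ y)) =
      dirDeriv e₂ (gaussianCurvature g) := funext fun y ↦ inner_flat_symm g y _ _
  have b1 := h.inner_leviCivita₁ hg hx (gradient g (gaussianCurvature g) x)
  have b2 := h.inner_leviCivita₂ hg hx (gradient g (gaussianCurvature g) x)
  rw [i1, congrFun i2 x, h.dirDeriv_gradient hx, h.connForm_gradient hx] at b1
  rw [i2, congrFun i1 x, h.dirDeriv_gradient hx, h.connForm_gradient hx] at b2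
  set c₁ := dirDeriv e₁ (gaussianCurvature g) x
  set c₂ := dirDeriv e₂ (gaussianCurvature g) x
  set W := leviCivita g (gradient g (gaussianCurvature g)) x (gradient g (gaussianCurvature g) x)
    with hW
  have par : c₁ * g.inner x W (e₂ x) = c₂ * g.inner x W (e₁ x) := by
    rw [b1, b2]
    linear_combination key
  -- At a critical point of `c` the direction `∂c` is zero and both sides vanish. Elsewhere the
  -- factor is that of the orthogonal projection, `g(D_{∂c} ∂c, ∂c) / |∂c|²`.
  by_cases hc : c₁ ^ 2 + c₂ ^ 2 = 0
  · have hc1 : c₁ = 0 := by nlinarith [sq_nonneg c₁, sq_nonneg c₂]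
    have hc2 : c₂ = 0 := by nlinarith [sq_nonneg c₁, sq_nonneg c₂]
    have hgrad : gradient g (gaussianCurvature g) x = 0 := by
      rw [h.gradient_eq hx]
      change c₁ • _ + c₂ • _ = _
      simp [hc1, hc2]
    exact ⟨0, by rw [hW, hgrad]; simp⟩
  · refine ⟨(c₁ * g.inner x W (e₁ x) + c₂ * g.inner x W (e₂ x)) / (c₁ ^ 2 + c₂ ^ 2),
      h.ext hx ?_ ?_⟩
    · rw [map_smul, smul_apply, congrFun i1 x, smul_eq_mul, div_mul_eq_mul_div, eq_div_iff hc]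
      change _ = _ * c₁
      linear_combination (-c₂) * par
    · rw [map_smul, smul_apply, congrFun i2 x, smul_eq_mul, div_mul_eq_mul_div, eq_div_iff hc]
      change _ = _ * c₂
      linear_combination c₁ * par

end IsOrthonormalFrameOn

end
end RiemannianGeometry

end

theorem mainTheorem8 {M : Type*} [TopologicalSpace M] [T2Space M] [SecondCountableTopology M]
    [ChartedSpace (EuclideanSpace ℝ (Fin 2)) M] [IsManifold (𝓡 2) ∞ M]
    (g : ContMDiffRiemannianMetric (𝓡 2) ∞ (EuclideanSpace ℝ (Fin 2))
      (TangentSpace (𝓡 2) : M → Type _))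
    (hreg : RiemannianGeometry.IsRegular g)
    (hKilling : ∃ K : Π x : M, TangentSpace (𝓡 2) x →L[ℝ] ℝ,
      RiemannianGeometry.IsKillingField g K ∧ K ≠ 0) :
    (∀ x : M, RiemannianGeometry.wedge
      (mvfderiv (𝓡 2) (RiemannianGeometry.gaussianCurvature g) x)
      (RiemannianGeometry.covectorDeriv (RiemannianGeometry.leviCivita g)
        (mvfderiv (𝓡 2) (RiemannianGeometry.gaussianCurvature g)) x
        (RiemannianGeometry.gradient g (RiemannianGeometry.gaussianCurvature g) x)) = 0) ∧
    ∃ f : M → ℝ, ∀ x : M,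
      RiemannianGeometry.leviCivita g
        (RiemannianGeometry.gradient g (RiemannianGeometry.gaussianCurvature g)) x
        (RiemannianGeometry.gradient g (RiemannianGeometry.gaussianCurvature g) x) =
      f x • RiemannianGeometry.gradient g (RiemannianGeometry.gaussianCurvature g) x := by
  obtain ⟨K, hK, h0⟩ := hKilling
  refine ⟨fun x ↦ ?_, ?_⟩
  · obtain ⟨U, e₁, e₂, hx, h⟩ := RiemannianGeometry.exists_isOrthonormalFrameOn g (by simp) x
    exact h.wedge_gaussianCurvature hreg hK h0 hx
  · have hex : ∀ x : M, ∃ a : ℝ, RiemannianGeometry.leviCivita g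
        (RiemannianGeometry.gradient g (RiemannianGeometry.gaussianCurvature g)) x
        (RiemannianGeometry.gradient g (RiemannianGeometry.gaussianCurvature g) x) =
        a • RiemannianGeometry.gradient g (RiemannianGeometry.gaussianCurvature g) x := by
      intro x
      obtain ⟨U, e₁, e₂, hx, h⟩ := RiemannianGeometry.exists_isOrthonormalFrameOn g (by simp) x
      exact h.leviCivita_gradient hreg hK h0 hx
    choose f hf using hex
    exact ⟨f, hf⟩
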